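/- **Setting.** Let $d\ge 2$ and let $R\ge 3$ be odd. Write $e$ / $o$ for an arbitrary even / odd integer. The cluster lattice $\mathcal C=\mathcal C[d\times d\times R]$ is the set of $u\in\mathbb Z^3$ with $1\le u_1\le 2d-1$, $0\le u_2\le 2d-2$, $1\le u_3\le R$ that are neither of type $(o,o,o)$ nor of type $(e,e,e)$. There is one qubit at each site of $\mathcal C$, and $\mathrm{neigh}(u)$ is the set of $v\in\mathcal C$ at $\ell_1$-distance $1$ from $u$. The cluster state is $W|0^{\mathcal C}\rangle$ with $W=H(\mathcal C)\bigl(\prod_{\{u,v\}}CZ_{u,v}\bigr)H(\mathcal C)$, the product running over all pairs of neighbours in $\mathcal C$. Let $q_1=(1,0,1)$, $q_2=(1,0,R)$; let $\mathcal B$ be the set of sites of type $(e,o,\cdot)$ or $(o,e,\cdot)$ with $u_3\in\{1,R\}$, and $\mathcal A=\mathcal C\setminus\mathcal B$; let $\mathcal X$ (resp. $\mathcal Z$) be the set of $u\in\mathcal B\setminus\{q_1,q_2\}$ with $u_2\ge u_1+1$ (resp. $u_2<u_1+1$). *Decoding graph* $\mathsf T$. Its vertices are, among the points with $0\le u_1\le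 2d$, $0\le u_2\le 2d-2$, $1\le u_3\le R$: the bulk sites $(e,e,e)$ with $2\le u_1\le 2d-2$; the boundary sites $(e,e,1),(e,e,R)$ with $u_1\ne 0,2d$, and $(0,e,e),(2d,e,e)$; and the layer sites $(e,e,1),(e,e,R)$ with $u_2\ge u_1$, $u_2>0$. Its edges are: the pairs of bulk or boundary sites at distance $2$ that are not both boundary sites; the pairs of bulk or boundary sites at distance $1$; and the pairs of layer sites in a common layer at distance $2$ that do not both have $u_1=0$. Its internal vertices are the bulk sites and the $(e,e,1),(e,e,R)$ with $0<u_1<u_2$. *Dual decoding graph* $\mathsf T^*$. Its vertices are the sites $(o,o,o)$ with $1\le u_1\le 2d-1$, $-1\le u_2\le 2d-1$, $1\le u_3\le R$. Those with $u_2\notin\{-1,2d-1\}$ and $u_3\notin\{1,R\}$ are bulk sites; those satisfying exactly one of these two conditions are boundary sites; those with $u_3\in\{1,R\}$, $u_2\le u_1$ and $(u_1,u_2)\ne(1,-1)$ are layer sites. Its edges are: the pairs of bulk or boundary sites at distance $2$ that are not both boundary sites (for $R=3$ also the pairs of boundary sites at distance $2$ with different $u_3$); and the pairs of layer sites in a common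 layer at distance $2$ that do not both have $u_2=-1$. Its internal vertices are the bulk sites and the $(o,o,1),(o,o,R)$ with $0<u_2<u_1$. An edge of length $2$ is identified with the qubit at its midpoint, an edge of length $1$ with the qubit at its endpoint in the layer $u_3=1$ or $u_3=R$; this identifies the edges of $\mathsf T$ and $\mathsf T^*$ together with $\mathcal C\setminus\{q_1,q_2\}$. For a set of edges, $\partial$ is the set of internal vertices incident to an odd number of them. Let $\mathcal L_X=\{(1,u_2,u_3)\in\mathcal C: u_2\text{ even, and either }u_3\text{ even, or }u_3\in\{1,R\},\,u_2\ge2\}$ and $\mathcal L_Z^*=\{(o,0,o)\}\setminus\{q_1,q_2\}$, and let $\langle S,T\rangle=|S\cap T|\bmod 2$. $\mathsf{MinMatch}$ denotes any function that maps each set $s$ of internal vertices of a graph to an edge set of minimal size among those with boundary $s$. *Protocol.* Measure the qubits of $\mathcal A\cup\mathcal Z$ in the $Z$-basis and those of $\mathcal X$ in the $X$-basis, with outcomes $a,z,x$ (identified with sets of qubits). Compute $s=\partial_{\mathsf T}((a\cap \mathsf T)\oplus x)$ and $s^*=\partial_{\mathsf T^*}((a\cap \mathsf T^*)\oplus z)$,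 then $\hat s^X=\langle \mathsf{MinMatch}_{\mathsf T}(s),\mathcal L_X\rangle$ and $\hat s^Z=\langle\mathsf{MinMatch}_{\mathsf T^*}(s^*),\mathcal L_Z^*\rangle$, then $\hat c_X=\langle a,\mathcal L_X\cap\mathcal A\rangle\oplus\langle x,\mathcal L_X\cap\mathcal B\rangle\oplus\hat s^X$ and $\hat c_Z=\langle a,\mathcal L^*_Z\cap\mathcal A\rangle\oplus\langle z,\mathcal L^*_Z\cap\mathcal B\rangle\oplus\hat s^Z$; apply $Z^{\hat c_X}X^{\hat c_Z}$ to $q_1$ and return the state of $q_1,q_2$. A *scheme of this type* is the same protocol with $\hat s^X=g(s)$ and $\hat s^Z=g^*(s^*)$ for arbitrary binary functions $g,g^*$. *Noise.* The protocol is run on $EW|0^{\mathcal C}\rangle$, where $E=\prod_{c\in\mathcal C}X_c^{y_c}$ with independent bits $y_c$, $\Pr[y_c=1]=p$. Let $\nu_{(0,0)}$ be the probability (over $E$ and the measurement outcomes) that the returned state is the Bell state $\Phi_{(0,0)}=\frac1{\sqrt2}(|00\rangle+|11\rangle)$. **Theorem.** Let $0<p\le\frac14$. 1. There is $d_0=d_0(p)$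 such that for all even $d\ge \max(d_0,2)$ and all odd $R\ge3$ with $R\ge\bigl(\frac1{2\sqrt p}\bigr)^d$, the protocol satisfies $\nu_{(0,0)}\le\frac34$. The same holds (with the same $d_0$) for every scheme of this type, i.e. when $\mathsf{MinMatch}$ is replaced by arbitrary binary functions. 2. Consequently every scheme of this type needs $m=\Omega(\log^2R)$ qubits per repeater: there is $c=c(p)>0$ such that for all $d\ge2$, all odd $R\ge3$ and all binary functions $g,g^*$, if $\nu_{(0,0)}>\frac34$, then the number $m$ of qubits in each plane of constant $u_3\in\{1,\dots,R\}$ satisfies $m\ge c\,(\log R)^2$. -/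

import Mathlib

open scoped BigOperators symmDiff Kronecker

noncomputable section

namespace ClusterProtocol

/-! ### The three-dimensional cluster lattice -/

/-- Sites of the (primal and dual) lattice, as points of `ℤ³`. -/
abbrev Site : Type := ℤ × ℤ × ℤ

/-- Manhattan distance. -/
def dist (u v : Site) : ℤ := |u.1 - v.1| + |u.2.1 - v.2.1| + |u.2.2 - v.2.2|

/-- The cluster lattice `𝒞[d × d × R]`: the locations of the qubits. -/
def qubits (d R : ℕ) : Finset Site :=
  (Finset.Icc (1 : ℤ) (2 * d - 1) ×ˢ Finset.Icc (0 : ℤ) (2 * d - 2) ×ˢ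
      Finset.Icc (1 : ℤ) R).filter fun u =>
    ¬ (Odd u.1 ∧ Odd u.2.1 ∧ Odd u.2.2) ∧ ¬ (Even u.1 ∧ Even u.2.1 ∧ Even u.2.2)

/-- The qubits of one repeater station: those in the plane `u₃ = k`. -/
def sheet (d R : ℕ) (k : ℤ) : Finset Site := (qubits d R).filter fun u => u.2.2 = k

/-- Qubits at Manhattan distance one from the site `u`. -/
def neigh (d R : ℕ) (u : Site) : Finset Site := (qubits d R).filter fun v => dist u v = 1

/-- Qubits at Manhattan distance one from `u` in the plane through `u` with constant `u₃`. -/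
def neighLayer (d R : ℕ) (u : Site) : Finset Site := (neigh d R u).filter fun v => v.2.2 = u.2.2

/-- The unmeasured qubit in the front layer. -/
def q₁ : Site := (1, 0, 1)

/-- The unmeasured qubit in the back layer. -/
def q₂ (R : ℕ) : Site := (1, 0, R)

/-- The set `ℬ` of surface-code qubits in the front and back layers. -/
def setB (d R : ℕ) : Finset Site :=
  (qubits d R).filter fun u =>
    (u.2.2 = 1 ∨ u.2.2 = R) ∧ (Even u.1 ∧ Odd u.2.1 ∨ Odd u.1 ∧ Even u.2.1)

/-- The set `𝒜 = 𝒞 ∖ ℬ`, measured in the `Z`-basis. -/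
def setA (d R : ℕ) : Finset Site := qubits d R \ setB d R

/-- The set `𝒳`, measured in the `X`-basis. -/
def setX (d R : ℕ) : Finset Site :=
  (setB d R \ {q₁, q₂ R}).filter fun u => 1 + u.1 ≤ u.2.1

/-- The set `𝒵`, measured in the `Z`-basis. -/
def setZ (d R : ℕ) : Finset Site :=
  (setB d R \ {q₁, q₂ R}).filter fun u => u.2.1 < 1 + u.1

/-- All measured qubits, i.e. `𝒜 ∪ 𝒳 ∪ 𝒵`. -/
def measured (d R : ℕ) : Finset Site := qubits d R \ {q₁, q₂ R}

/-! ### Decoding graphs -/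

/-- The edges `{u, v}` with `u, v ∈ V` and `r u v`. -/
def edgesOf (V : Finset Site) (r : Site → Site → Prop) [DecidableRel r] : Finset (Sym2 Site) :=
  ((V ×ˢ V).filter fun w => r w.1 w.2).image fun w => s(w.1, w.2)

/-- The labelling map `Λ` from edges to sites: the midpoint of an edge of length two, and the
endpoint in the front or back layer (these have odd `u₃`) for an edge of length one between
the layers `1, 2` or `R - 1, R`. -/
def label : Sym2 Site → Site :=
  Sym2.lift ⟨fun u v => ((u.1 + v.1) / 2, (u.2.1 + v.2.1) / 2,
      if Even (u.2.2 + v.2.2) then (u.2.2 + v.2.2) / 2 else if Odd u.2.2 then u.2.2 else v.2.2), by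
    intro u v
    dsimp only
    rw [add_comm v.1, add_comm v.2.1, add_comm v.2.2]
    rcases Int.even_or_odd u.2.2 with hu | hu <;> rcases Int.even_or_odd v.2.2 with hv | hv <;>
      simp_all [Int.even_add, ← Int.not_even_iff_odd]⟩

/-- The set of labels of a set of edges. -/
def labels (E : Finset (Sym2 Site)) : Finset Site := E.image label

/-- A finite graph (given by its edges) with distinguished internal vertices. -/
structure DecodingGraph where
  edges : Finset (Sym2 Site)
  internal : Finset Site

/-- The boundary `∂`: internal vertices incident to an odd number of the given edges. -/
def DecodingGraph.boundary (G : DecodingGraph) (m : Finset (Sym2 Site)) : Finset Site :=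
  G.internal.filter fun u => Odd (m.filter fun e => u ∈ e).card

/-- `m` is a matching of the set `s` of internal vertices. -/
def DecodingGraph.IsMatching (G : DecodingGraph) (m : Finset (Sym2 Site)) (s : Finset Site) :
    Prop :=
  m ⊆ G.edges ∧ G.boundary m = s

/-- `M` returns a matching of minimal size for every set of internal vertices. -/
def DecodingGraph.IsMinMatch (G : DecodingGraph) (M : Finset Site → Finset (Sym2 Site)) : Prop :=
  ∀ s ⊆ G.internal, G.IsMatching (M s) s ∧ ∀ m, G.IsMatching m s → (M s).card ≤ m.card

/-- Primal sites `(e, e, ·)`. -/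
def evenEvenSites (d R : ℕ) : Finset Site :=
  (Finset.Icc (0 : ℤ) (2 * d) ×ˢ Finset.Icc (0 : ℤ) (2 * d - 2) ×ˢ
    Finset.Icc (1 : ℤ) R).filter fun u => Even u.1 ∧ Even u.2.1

/-- Dual sites `(o, o, ·)`. -/
def oddOddSites (d R : ℕ) : Finset Site :=
  (Finset.Icc (1 : ℤ) (2 * d - 1) ×ˢ Finset.Icc (-1 : ℤ) (2 * d - 1) ×ˢ
    Finset.Icc (1 : ℤ) R).filter fun u => Odd u.1 ∧ Odd u.2.1

/-- Bulk vertices `V°_even`. -/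
def evenBulk (d R : ℕ) : Finset Site :=
  (evenEvenSites d R).filter fun u => Even u.2.2 ∧ 2 ≤ u.1 ∧ u.1 ≤ 2 * d - 2

/-- Boundary vertices `V'_even` (front, back, left and right). -/
def evenBoundary (d R : ℕ) : Finset Site :=
  (evenEvenSites d R).filter fun u =>
    ((u.2.2 = 1 ∨ u.2.2 = R) ∧ u.1 ≠ 0 ∧ u.1 ≠ 2 * d) ∨
      (Even u.2.2 ∧ (u.1 = 0 ∨ u.1 = 2 * d))

/-- Edges of the even graph `T_even`. -/
def evenEdges (d R : ℕ) : Finset (Sym2 Site) :=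
  edgesOf (evenBulk d R ∪ evenBoundary d R) fun u v =>
    (dist u v = 2 ∧ ¬ (u ∈ evenBoundary d R ∧ v ∈ evenBoundary d R)) ∨ dist u v = 1

/-- Vertices of `T_dec × {1, R}`. -/
def decVertices (d R : ℕ) : Finset Site :=
  (evenEvenSites d R).filter fun u =>
    (u.2.2 = 1 ∨ u.2.2 = R) ∧ u.1 ≤ u.2.1 ∧ 0 < u.2.1

/-- Edges of `T_dec × {1, R}`: two copies of the subgraph of the surface code graph induced by
the vertices above (the surface code graph has no edges within the line `u₁ = 0`). -/
def decEdges (d R : ℕ) : Finset (Sym2 Site) :=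
  edgesOf (decVertices d R) fun u v =>
    u.2.2 = v.2.2 ∧ dist u v = 2 ∧ ¬ (u.1 = 0 ∧ v.1 = 0)

/-- The decoding graph `T_{cl,dec} = T_even ∪ (T_dec × {1, R})`. A vertex is internal if it is not
the endpoint of a dangling edge at `u₁ = 0` or `u₁ = 2d` and all its neighbouring qubits label
edges of the graph. -/
def decGraph (d R : ℕ) : DecodingGraph where
  edges := evenEdges d R ∪ decEdges d R
  internal :=
    ((evenBulk d R ∪ evenBoundary d R).filter fun u =>
      u.1 ≠ 0 ∧ u.1 ≠ 2 * d ∧ neigh d R u ⊆ labels (evenEdges d R)) ∪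
    ((decVertices d R).filter fun u =>
      u.1 ≠ 0 ∧ neighLayer d R u ⊆ labels (decEdges d R))

/-- Bulk vertices `V°_odd`. -/
def oddBulk (d R : ℕ) : Finset Site :=
  (oddOddSites d R).filter fun u =>
    Odd u.2.2 ∧ u.2.1 ≠ -1 ∧ u.2.1 ≠ 2 * d - 1 ∧ u.2.2 ≠ 1 ∧ u.2.2 ≠ R

/-- Boundary vertices `V'_odd` (front, back, bottom and top). -/
def oddBoundary (d R : ℕ) : Finset Site :=
  (oddOddSites d R).filter fun u =>
    ((u.2.2 = 1 ∨ u.2.2 = R) ∧ u.2.1 ≠ -1 ∧ u.2.1 ≠ 2 * d - 1) ∨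
      (Odd u.2.2 ∧ (u.2.1 = -1 ∨ u.2.1 = 2 * d - 1) ∧ u.2.2 ≠ 1 ∧ u.2.2 ≠ R)

/-- Edges of the odd graph `T_odd`: vertices at distance two that do not both lie in the boundary.
For `R = 3` there are no bulk vertices, and the front and back layers are joined directly, so that
the qubits `(o, o, 2)` label edges as they do for all other `R`. -/
def oddEdges (d R : ℕ) : Finset (Sym2 Site) :=
  edgesOf (oddBulk d R ∪ oddBoundary d R) fun u v =>
    dist u v = 2 ∧
      (¬ (u ∈ oddBoundary d R ∧ v ∈ oddBoundary d R) ∨ (R = 3 ∧ u.2.2 ≠ v.2.2))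

/-- Vertices of `T_{dec*} × {1, R}`. -/
def dualDecVertices (d R : ℕ) : Finset Site :=
  (oddOddSites d R).filter fun u =>
    (u.2.2 = 1 ∨ u.2.2 = R) ∧ u.2.1 ≤ u.1 ∧ ¬ (u.1 = 1 ∧ u.2.1 = -1)

/-- Edges of `T_{dec*} × {1, R}` (the dual surface code graph has no edges within the line
`u₂ = -1`). -/
def dualDecEdges (d R : ℕ) : Finset (Sym2 Site) :=
  edgesOf (dualDecVertices d R) fun u v =>
    u.2.2 = v.2.2 ∧ dist u v = 2 ∧ ¬ (u.2.1 = -1 ∧ v.2.1 = -1)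

/-- The dual decoding graph `T_{cl,dec*} = T_odd ∪ (T_{dec*} × {1, R})`, with dangling edges at
`u₂ = -1` and `u₂ = 2d - 1`. -/
def dualDecGraph (d R : ℕ) : DecodingGraph where
  edges := oddEdges d R ∪ dualDecEdges d R
  internal :=
    ((oddBulk d R ∪ oddBoundary d R).filter fun u =>
      u.2.1 ≠ -1 ∧ u.2.1 ≠ 2 * d - 1 ∧ neigh d R u ⊆ labels (oddEdges d R)) ∪
    ((dualDecVertices d R).filter fun u =>
      u.2.1 ≠ -1 ∧ u.2.1 ≠ 2 * d - 1 ∧ neighLayer d R u ⊆ labels (dualDecEdges d R))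

/-- The recovery set `ℒ_{cl,X}`, by labels. -/
def recoveryX (d R : ℕ) : Finset Site :=
  (qubits d R).filter fun u => u.1 = 1 ∧ Even u.2.1 ∧
    ((2 ≤ u.2.1 ∧ (u.2.2 = 1 ∨ u.2.2 = R)) ∨ Even u.2.2)

/-- The dual recovery set `ℒ*_{cl,Z}`, by labels. -/
def recoveryZ (d R : ℕ) : Finset Site :=
  (qubits d R \ {q₁, q₂ R}).filter fun u => Odd u.1 ∧ u.2.1 = 0 ∧ Odd u.2.2

/-- The parity `⟨S, T⟩` of `|S ∩ T|`. -/
def parity (S T : Finset Site) : ZMod 2 := ((S ∩ T).card : ZMod 2)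

/-! ### Qubits, gates and the cluster state -/

/-- The qubits as a type. -/
abbrev Qubit (d R : ℕ) : Type := ↥(qubits d R)

/-- Pauli `X`. -/
def pauliX : Matrix (ZMod 2) (ZMod 2) ℂ := Matrix.of fun a b => if a = b + 1 then 1 else 0

/-- Pauli `Z`. -/
def pauliZ : Matrix (ZMod 2) (ZMod 2) ℂ := Matrix.diagonal fun a => (-1) ^ a.val

/-- The Hadamard gate. -/
def hadamard : Matrix (ZMod 2) (ZMod 2) ℂ :=
  Matrix.of fun a b => ((1 / √2 : ℝ) : ℂ) * (-1) ^ (a * b).val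

/-- The tensor product of single-qubit operators, in the computational basis. -/
def tensorOp {ι : Type} [Fintype ι] (A : ι → Matrix (ZMod 2) (ZMod 2) ℂ) :
    Matrix (ι → ZMod 2) (ι → ZMod 2) ℂ :=
  Matrix.of fun b b' => ∏ i, A i (b i) (b' i)

/-- `H(Ω)`: a Hadamard gate on each qubit of `Ω`. -/
def hadamardOn (d R : ℕ) (Ω : Finset Site) :
    Matrix (Qubit d R → ZMod 2) (Qubit d R → ZMod 2) ℂ :=
  tensorOp fun c => if c.1 ∈ Ω then hadamard else 1

/-- The graph of the cluster state. -/
def clusterGraph (d R : ℕ) : SimpleGraph (Qubit d R) where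
  Adj u v := dist u.1 v.1 = 1
  symm := ⟨fun u v h => by
    simpa only [dist, abs_sub_comm] using h⟩
  loopless := ⟨fun u h => by simp [dist] at h⟩

instance (d R : ℕ) : DecidableRel (clusterGraph d R).Adj :=
  fun u v => inferInstanceAs (Decidable (dist u.1 v.1 = 1))

/-- The (diagonal) product of the gates `CZ_{u,v}` over all edges of the cluster graph. -/
def prodCZ (d R : ℕ) : Matrix (Qubit d R → ZMod 2) (Qubit d R → ZMod 2) ℂ :=
  Matrix.diagonal fun b =>
    ∏ e ∈ (clusterGraph d R).edgeFinset, if ∀ c ∈ e, b c = 1 then -1 else 1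

/-- The circuit `W = H(𝒞) (∏ CZ) H(𝒞)`. -/
def circuitW (d R : ℕ) :
    Matrix (Qubit d R → ZMod 2) (Qubit d R → ZMod 2) ℂ :=
  hadamardOn d R (qubits d R) * prodCZ d R * hadamardOn d R (qubits d R)

/-- The bit-flip error `E = ∏_c X_c^{y_c}`. -/
def bitFlip (d R : ℕ) (y : Qubit d R → ZMod 2) :
    Matrix (Qubit d R → ZMod 2) (Qubit d R → ZMod 2) ℂ :=
  tensorOp fun c => pauliX ^ (y c).val

/-- The input state `E W |0^𝒞⟩`. -/
def inputState (d R : ℕ) (y : Qubit d R → ZMod 2) : (Qubit d R → ZMod 2) → ℂ :=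
  (bitFlip d R y).mulVec ((circuitW d R).mulVec (Pi.single 0 1))

/-- The Bell state `Φ`. -/
def bellPhi : ZMod 2 × ZMod 2 → ℂ :=
  fun t => if t.1 = t.2 then ((1 / √2 : ℝ) : ℂ) else 0

/-- The Bell basis `Φ_{(α,β)} = (I ⊗ Z^α X^β) Φ`. -/
def bell (α β : ZMod 2) : ZMod 2 × ZMod 2 → ℂ :=
  ((1 : Matrix (ZMod 2) (ZMod 2) ℂ) ⊗ₖ (pauliZ ^ α.val * pauliX ^ β.val)).mulVec bellPhi

/-! ### The protocol -/

/-- Measurement outcomes `(a, x, z)`: one bit for each measured qubit. -/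
abbrev Outcome (d R : ℕ) : Type := ↥(measured d R) → ZMod 2

/-- The set of measured qubits with outcome `1`. -/
def ones {d R : ℕ} (o : Outcome d R) : Finset Site :=
  (Finset.univ.filter fun c => o c = 1).image Subtype.val

/-- The computational basis string with values `o` on the measured qubits and `t` on `q₁, q₂`. -/
def glue {d R : ℕ} (o : Outcome d R) (t : ZMod 2 × ZMod 2) : Qubit d R → ZMod 2 := fun c =>
  if h : c.1 ∈ measured d R then o ⟨c.1, h⟩ else if c.1 = q₁ then t.1 else t.2

/-- The unnormalised post-measurement state `(⟨a| ⊗ ⟨x|H(𝒳) ⊗ ⟨z| ⊗ I_{q₁,q₂}) E W |0^𝒞⟩`. -/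
def postMeasurement (d R : ℕ) (y : Qubit d R → ZMod 2) (o : Outcome d R) :
    ZMod 2 × ZMod 2 → ℂ := fun t =>
  (hadamardOn d R (setX d R)).mulVec (inputState d R y) (glue o t)

/-- The probability of the outcome `o` given the error `y`. -/
def outcomeProb (d R : ℕ) (y : Qubit d R → ZMod 2) (o : Outcome d R) : ℝ :=
  ∑ t, ‖postMeasurement d R y o t‖ ^ 2

/-- The edges of `G` whose label belongs to `S`. -/
def DecodingGraph.edgesLabelled (G : DecodingGraph) (S : Finset Site) : Finset (Sym2 Site) :=
  G.edges.filter fun e => label e ∈ S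

/-- The syndrome `s = ∂((a ∩ E_{cl,dec}) ⊕ x)`. -/
def syndrome {d R : ℕ} (o : Outcome d R) : Finset Site :=
  (decGraph d R).boundary ((decGraph d R).edgesLabelled
    (((ones o ∩ setA d R) ∩ labels (decGraph d R).edges) ∆ (ones o ∩ setX d R)))

/-- The dual syndrome `s* = ∂((a ∩ E_{cl,dec*}) ⊕ z)`. -/
def dualSyndrome {d R : ℕ} (o : Outcome d R) : Finset Site :=
  (dualDecGraph d R).boundary ((dualDecGraph d R).edgesLabelled
    (((ones o ∩ setA d R) ∩ labels (dualDecGraph d R).edges) ∆ (ones o ∩ setZ d R)))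

/-- The estimate `ŝ^X = ⟨m, ℒ_{cl,X}⟩` computed from the set `m = M(s)` of edges. -/
def estimateX (d R : ℕ) (M : Finset Site → Finset (Sym2 Site)) : Finset Site → ZMod 2 :=
  fun s => (((M s).filter fun e => label e ∈ recoveryX d R).card : ZMod 2)

/-- The estimate `ŝ^Z = ⟨m*, ℒ*_{cl,Z}⟩` computed from the set `m* = M(s*)` of edges. -/
def estimateZ (d R : ℕ) (M : Finset Site → Finset (Sym2 Site)) : Finset Site → ZMod 2 :=
  fun s => (((M s).filter fun e => label e ∈ recoveryZ d R).card : ZMod 2)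

/-- The bit `ĉ_X`, where `g` computes `ŝ^X` from the syndrome. -/
def correctionX {d R : ℕ} (g : Finset Site → ZMod 2) (o : Outcome d R) : ZMod 2 :=
  parity (ones o ∩ setA d R) (recoveryX d R ∩ setA d R) +
    parity (ones o ∩ setX d R) (recoveryX d R ∩ setB d R) + g (syndrome o)

/-- The bit `ĉ_Z`, where `g` computes `ŝ^Z` from the dual syndrome. -/
def correctionZ {d R : ℕ} (g : Finset Site → ZMod 2) (o : Outcome d R) : ZMod 2 :=
  parity (ones o ∩ setA d R) (recoveryZ d R ∩ setA d R) +
    parity (ones o ∩ setZ d R) (recoveryZ d R ∩ setB d R) + g (dualSyndrome o)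

/-- The (unnormalised) state on `q₁, q₂` returned by the protocol: the correction
`Z^{ĉ_X} X^{ĉ_Z}` is applied to `q₁`. -/
def outputState (d R : ℕ) (gX gZ : Finset Site → ZMod 2)
    (y : Qubit d R → ZMod 2) (o : Outcome d R) : ZMod 2 × ZMod 2 → ℂ :=
  ((pauliZ ^ (correctionX gX o).val * pauliX ^ (correctionZ gZ o).val) ⊗ₖ
    (1 : Matrix (ZMod 2) (ZMod 2) ℂ)).mulVec (postMeasurement d R y o)

/-- Two unnormalised vectors describe the same pure state. -/
def SameState (φ χ : ZMod 2 × ZMod 2 → ℂ) : Prop := ∃ c : ℂ, c ≠ 0 ∧ φ = c • χ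

/-- The probability of `y` when its entries are independent Bernoulli-`p` bits. -/
def bernoulliWeight {ι : Type} [Fintype ι] (p : ℝ) (y : ι → ZMod 2) : ℝ :=
  ∏ c, if y c = 1 then p else 1 - p

open scoped Classical in
/-- `ν_{(α,β)}`: the probability, over the i.i.d. bit-flip error of strength `p` and the measurement
outcomes, that the protocol returns the Bell state `Φ_{(α,β)}`, when the bits `ŝ^X` and `ŝ^Z` are
computed from the syndromes `s` and `s*` by `gX` and `gZ`. -/
def bellProb (d R : ℕ) (p : ℝ) (gX gZ : Finset Site → ZMod 2) (α β : ZMod 2) : ℝ :=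
  ∑ y : Qubit d R → ZMod 2, bernoulliWeight p y *
    ∑ o : Outcome d R, if SameState (outputState d R gX gZ y o) (bell α β) then
      outcomeProb d R y o else 0

end ClusterProtocol

end

noncomputable section

namespace ClusterProtocol

/-! Only bit flips in the planes of even `u₃` matter. Such a plane carries a layer of the decoding
graph whose vertices at `u₁ = 0` and `u₁ = 2d` are not internal. Flipping the qubits on a path from
one of these sides to the other therefore leaves the syndrome `s` unchanged. If the path meets
`recoveryX` once, the bit `ĉ_X` is reversed while the post-measurement state stays the same up to
the relabelling of outcomes. So no function of the syndromes succeeds both on an error and on that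
error plus such a path (`not_success_of_cycle`).

There are `N = (R - 1) / 2` such planes with independent errors. Suppose that in each of them some
part of the error distribution, of mass `β`, is invariant under a pairing of errors that differ by
crossing paths. Once one plane falls into this part, success has conditional probability at most one
half, so success has probability at most `1/2 + (1 - β)^N / 2` (`sum_prod_le_of_half`). This is at
most `3/4` as soon as `N β ≥ 1`. It remains to make `β` large.

Every error on a straight line of `d` edges has probability at least `p^d`, so complementation gives
`β = (2p)^d`. This holds for all `d ≥ 2` and already yields the `log²` bound, as a plane contains at
least `d²` qubits.

The threshold `(1/(2√p))^d` is sharper. Errors with half of the edges of a line flipped would give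
about `(2√(p(1-p)))^d`, which is still too small by an exponential factor. The line is therefore
thickened to a tube, in which each of `n = d - 2` direct edges has a three-edge detour. A block then
contributes its Bhattacharyya coefficient, the sum over its syndromes of `2√(P₀ P₁)` with `P₀, P₁`
the probabilities of the two homology classes. The number of paths more than compensates for the
factor `√(1-p)`: the coefficient exceeds `2√p` when `p(1-p) < 1/8` (`two_mul_sqrt_lt_blockRate`),
and the exponential gain absorbs the polynomial loss from restricting to exactly balanced errors.

When `p(1-p) ≥ 1/8` no coding argument is needed: flipping exactly one of the unmeasured qubits is
undetectable, and alone bounds success by `1 - 2p(1-p) ≤ 3/4`. -/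

/-! ### Pairing arguments for independent copies. -/

open scoped Classical in
-- Two opposite fibres of `key` have equal mass and `J` can meet only one of them. Pairing fibres
-- rather than points allows several elements of `T` to be opposite to the same one.
theorem sum_ite_le_half_of_flip {T κ : Type*} [Fintype T] [Fintype κ] [DecidableEq κ]
    (key : T → κ) (flip : κ → κ)
    (hflip : Function.Involutive flip) (u : T → ℝ) (hu : ∀ t, 0 ≤ u t)
    (hU : ∀ k, ∑ t with key t = flip k, u t = ∑ t with key t = k, u t) (J : T → Prop)
    (hJ : ∀ t t', key t' = flip (key t) → J t → ¬ J t') :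
    ∑ t, (if J t then u t else 0) ≤ (∑ t, u t) / 2 := by
  set U : κ → ℝ := fun k => ∑ t with key t = k, u t with hUdef
  have hU0 : ∀ k, 0 ≤ U k := fun k => Finset.sum_nonneg fun t _ => hu t
  -- A fibre that meets `J` at all is counted in full; the hypothesis on `J` still excludes the
  -- opposite fibre.
  set J' : κ → Prop := fun k => ∃ t, key t = k ∧ J t with hJ'
  have hnot : ∀ k, J' k → ¬ J' (flip k) := by
    rintro k ⟨t, rfl, ht⟩ ⟨t', ht', h'⟩
    exact hJ t t' ht' ht h'
  have h1 : ∑ t, (if J t then u t else 0) ≤ ∑ k, if J' k then U k else 0 := by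
    rw [← Finset.sum_fiberwise (s := Finset.univ) (g := key)]
    refine Finset.sum_le_sum fun k _ => ?_
    split_ifs with hk
    · refine Finset.sum_le_sum fun t _ => ?_
      split_ifs
      exacts [le_rfl, hu t]
    · refine (Finset.sum_eq_zero fun t ht => ?_).le
      rw [if_neg]
      exact fun h => hk ⟨t, (Finset.mem_filter.1 ht).2, h⟩
  have h2 : ∑ k, (if J' k then U k else 0) = ∑ k, if J' (flip k) then U k else 0 := by
    rw [← Equiv.sum_comp hflip.toPerm]
    refine Finset.sum_congr rfl fun k _ => ?_
    have : U (flip k) = U k := hU k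
    simp [this]
  have h3 : ∑ k, (if J' k then U k else 0) + ∑ k, (if J' (flip k) then U k else 0) ≤ ∑ k, U k := by
    rw [← Finset.sum_add_distrib]
    refine Finset.sum_le_sum fun k _ => ?_
    have hk := hU0 k
    split_ifs with a b
    · exact absurd b (hnot k a)
    all_goals linarith
  have h4 : ∑ k, U k = ∑ t, u t := Finset.sum_fiberwise _ _ _
  linarith

open scoped Classical in
/-- If `N` independent copies of a system each have a sub-probability weight `u` on which success
has conditional probability at most one half, then success fails half of the time that any copy is
drawn from `u`. -/
theorem sum_prod_le_of_half {T : Type*} [Fintype T] (opp : T → T → Prop) (w u : T → ℝ) (β : ℝ)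
    (hw : ∑ t, w t = 1) (hu : ∀ t, 0 ≤ u t) (huw : ∀ t, u t ≤ w t) (hβ : ∑ t, u t = β)
    (hhalf : ∀ J : T → Prop, (∀ t t', opp t t' → J t → ¬ J t') →
      ∑ t, (if J t then u t else 0) ≤ β / 2)
    (N : ℕ) (J : (Fin N → T) → Prop)
    (hJ : ∀ f j t, opp (f j) t → J f → ¬ J (Function.update f j t)) :
    ∑ f, (if J f then ∏ j, w (f j) else 0) ≤ 1 / 2 + (1 - β) ^ N / 2 := by
  induction N with
  | zero =>
    simp only [Finset.univ_eq_empty, Finset.prod_empty, pow_zero, Finset.univ_unique,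
      Finset.sum_singleton]
    split_ifs <;> norm_num
  | succ N ih =>
    have hw0 : ∀ t, 0 ≤ w t := fun t => (hu t).trans (huw t)
    have hβ1 : β ≤ 1 := by rw [← hβ, ← hw]; exact Finset.sum_le_sum fun t _ => huw t
    have hprod : ∑ g : Fin N → T, ∏ j, w (g j) = 1 := by
      have := Finset.sum_pow' (s := (Finset.univ : Finset T)) w N
      rw [hw, one_pow] at this
      simpa using this.symm
    set A : T → ℝ := fun t =>
      ∑ g : Fin N → T, if J (Fin.cons t g) then ∏ j, w (g j) else 0 with hA
    have e1 : ∑ f, (if J f then ∏ j, w (f j) else 0) = ∑ t, w t * A t := by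
      rw [← Equiv.sum_comp (Fin.consEquiv fun _ : Fin (N + 1) => T), Fintype.sum_prod_type]
      refine Finset.sum_congr rfl fun t _ => ?_
      rw [hA, Finset.mul_sum]
      refine Finset.sum_congr rfl fun g _ => ?_
      simp [Fin.consEquiv, Fin.prod_univ_succ]
    -- First copy drawn from `u`: freeze the other copies and apply the one-half bound to each slice
    -- of `J`.
    have e2 : ∑ t, u t * A t ≤ β / 2 := by
      calc ∑ t, u t * A t
          = ∑ g : Fin N → T, (∏ j, w (g j)) *
              ∑ t, if J (Fin.cons t g) then u t else 0 := by
            simp only [hA, Finset.mul_sum]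
            rw [Finset.sum_comm]
            refine Finset.sum_congr rfl fun g _ => Finset.sum_congr rfl fun t _ => ?_
            split_ifs <;> ring
        _ ≤ ∑ g : Fin N → T, (∏ j, w (g j)) * (β / 2) := by
            refine Finset.sum_le_sum fun g _ => mul_le_mul_of_nonneg_left ?_
              (Finset.prod_nonneg fun j _ => hw0 _)
            refine hhalf _ fun t t' h ht => ?_
            have := hJ (Fin.cons t g) 0 t' (by simpa using h) ht
            rwa [Fin.update_cons_zero] at this
        _ = β / 2 := by rw [← Finset.sum_mul, hprod, one_mul]
    -- First copy drawn from the rest, of mass `1 - β`: nothing is gained here, and induction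
    -- applies to the other copies.
    have e3 : ∑ t, (w t - u t) * A t ≤ (1 - β) * (1 / 2 + (1 - β) ^ N / 2) := by
      calc ∑ t, (w t - u t) * A t ≤ ∑ t, (w t - u t) * (1 / 2 + (1 - β) ^ N / 2) := by
            refine Finset.sum_le_sum fun t _ => mul_le_mul_of_nonneg_left ?_
              (sub_nonneg.2 (huw t))
            refine ih _ fun f j t' h hf => ?_
            have := hJ (Fin.cons t f) j.succ t' (by simpa using h) hf
            rwa [← Fin.cons_update] at this
        _ = _ := by rw [← Finset.sum_mul, Finset.sum_sub_distrib, hw, hβ]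
    have e4 : ∑ t, w t * A t = ∑ t, u t * A t + ∑ t, (w t - u t) * A t := by
      rw [← Finset.sum_add_distrib]
      exact Finset.sum_congr rfl fun t _ => by ring
    rw [e1, e4]
    calc _ ≤ β / 2 + (1 - β) * (1 / 2 + (1 - β) ^ N / 2) := add_le_add e2 e3
      _ = _ := by ring

/-! ### Bernoulli bits and repetition codes. -/

/-- The probability of the value `b` of a Bernoulli-`p` bit. -/
def bern (p : ℝ) (b : ZMod 2) : ℝ := if b = 1 then p else 1 - p

theorem sum_zmod_two {M : Type*} [AddCommMonoid M] (f : ZMod 2 → M) : ∑ b, f b = f 0 + f 1 :=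
  Fin.sum_univ_two f

theorem forall_zmod_two {P : ZMod 2 → Prop} : (∀ b, P b) ↔ P 0 ∧ P 1 :=
  Fin.forall_fin_two

theorem bern_zero (p : ℝ) : bern p 0 = 1 - p := by simp [bern]

theorem bern_one (p : ℝ) : bern p 1 = p := by simp [bern]

theorem sum_bern (p : ℝ) : ∑ b, bern p b = 1 := by
  rw [sum_zmod_two, bern_zero, bern_one]; ring

theorem sum_prod_bern {ι : Type*} [Fintype ι] [DecidableEq ι] (p : ℝ) :
    ∑ y : ι → ZMod 2, ∏ i, bern p (y i) = 1 := by
  have := Finset.prod_univ_sum (fun _ : ι => (Finset.univ : Finset (ZMod 2)))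
    (fun _ b => bern p b)
  rw [Fintype.piFinset_univ] at this
  rw [← this]
  simp [sum_bern]

theorem le_bern {p : ℝ} (hp : p ≤ 1 / 2) (b : ZMod 2) : p ≤ bern p b := by
  unfold bern; split_ifs <;> linarith

theorem one_sub_pow_le_half {β : ℝ} {N : ℕ} (hβ : β ≤ 1) (h : 1 ≤ N * β) :
    (1 - β) ^ N ≤ 1 / 2 := by
  calc (1 - β) ^ N ≤ (Real.exp (-β)) ^ N :=
        pow_le_pow_left₀ (by linarith) (by linarith [Real.add_one_le_exp (-β)]) N
    _ = Real.exp (-(N * β)) := by rw [← Real.exp_nat_mul]; ring_nf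
    _ ≤ Real.exp (-1) := Real.exp_le_exp.2 (by linarith)
    _ ≤ 1 / 2 := by
        rw [Real.exp_neg, one_div]
        exact inv_anti₀ (by norm_num) (by linarith [Real.add_one_le_exp 1])

open scoped Classical in
/-- Failure of any decoder for `N` parallel repetition codes of length `d`. -/
theorem sum_lines_le {p : ℝ} (hp₀ : 0 < p) (hp : p ≤ 1 / 2) (d N : ℕ)
    (J : (Fin N → Fin d → ZMod 2) → Prop)
    (hJ : ∀ f j, J f → ¬ J (Function.update f j (f j + 1))) :
    ∑ f, (if J f then ∏ j, ∏ i, bern p (f j i) else 0) ≤ 1 / 2 + (1 - (2 * p) ^ d) ^ N / 2 := by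
  -- The subweight is the constant `p ^ d`: it lies below every product weight since `p ≤ 1 - p`,
  -- and it is trivially invariant under complementation.
  have hs : ∑ _t : Fin d → ZMod 2, p ^ d = (2 * p) ^ d := by
    rw [Finset.sum_const, Finset.card_univ, Fintype.card_fun, ZMod.card, Fintype.card_fin,
      nsmul_eq_mul, mul_pow, Nat.cast_pow, Nat.cast_ofNat]
  have hw : ∀ t : Fin d → ZMod 2, p ^ d ≤ ∏ i, bern p (t i) := fun t => by
    calc p ^ d = ∏ _i : Fin d, p := by rw [Finset.prod_const, Finset.card_univ, Fintype.card_fin]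
      _ ≤ _ := Finset.prod_le_prod (fun _ _ => hp₀.le) fun i _ => le_bern hp _
  have hinv : Function.Involutive fun t : Fin d → ZMod 2 => t + 1 := fun t => by
    funext i
    simp only [Pi.add_apply, Pi.one_apply, add_assoc]
    rw [show (1 : ZMod 2) + 1 = 0 by decide, add_zero]
  have hhalf : ∀ J : (Fin d → ZMod 2) → Prop, (∀ t t', t' = t + 1 → J t → ¬ J t') →
      ∑ t, (if J t then p ^ d else 0) ≤ (2 * p) ^ d / 2 := fun J hJ => by
    rw [← hs]
    refine sum_ite_le_half_of_flip id (fun t => t + 1) hinv (fun _ => p ^ d)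
      (fun _ => by positivity) (fun k => ?_) J hJ
    simp only [id, Finset.sum_const]
    congr 1
    rw [Finset.filter_eq', Finset.filter_eq', if_pos (Finset.mem_univ _),
      if_pos (Finset.mem_univ _), Finset.card_singleton, Finset.card_singleton]
  exact sum_prod_le_of_half (T := Fin d → ZMod 2) (fun t t' => t' = t + 1)
    (fun t => ∏ i, bern p (t i)) (fun _ => p ^ d) ((2 * p) ^ d) (sum_prod_bern p)
    (fun _ => by positivity) hw hs hhalf N J (by rintro f j t rfl; exact hJ f j)

/-! ### Balanced bit strings. -/

/-- Exactly half of the bits of `c` on `U` equal one. -/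
def HalfOnes {ι : Type*} [DecidableEq ι] (U : Finset ι) (c : ι → ZMod 2) : Prop :=
  2 * (U.filter fun i => c i = 1).card = U.card

instance {ι : Type*} [DecidableEq ι] (U : Finset ι) (c : ι → ZMod 2) : Decidable (HalfOnes U c) :=
  inferInstanceAs (Decidable (_ = _))

theorem HalfOnes.add_one {ι : Type*} [DecidableEq ι] {U : Finset ι} {c : ι → ZMod 2}
    (h : HalfOnes U c) : HalfOnes U (c + 1) := by
  unfold HalfOnes at *
  have h1 := Finset.card_filter_add_card_filter_not (s := U) (fun i => c i = 1)
  have h2 : (U.filter fun i => (c + 1) i = 1) = U.filter fun i => ¬ c i = 1 := by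
    refine Finset.filter_congr fun i _ => ?_
    have : ∀ b : ZMod 2, b + 1 = 1 ↔ ¬ b = 1 := by decide
    exact this (c i)
  rw [h2]
  omega

/-- Zeros and ones occur equally often, so the product depends on `U` alone, as a power of the
geometric mean. Balanced errors of opposite class thereby become equally likely. -/
theorem HalfOnes.prod_eq {ι : Type*} [DecidableEq ι] {U : Finset ι} {c : ι → ZMod 2}
    (h : HalfOnes U c) {f : ZMod 2 → ℝ} (hf : ∀ b, 0 ≤ f b) :
    ∏ i ∈ U, f (c i) = √(f 0 * f 1) ^ U.card := by
  unfold HalfOnes at h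
  have h1 := Finset.card_filter_add_card_filter_not (s := U) (fun i => c i = 1)
  have h2 : ∀ b : ZMod 2, f b = if b = 1 then f 1 else f 0 := by
    rw [forall_zmod_two]; simp
  rw [Finset.prod_congr rfl fun i _ => h2 (c i), Finset.prod_ite, Finset.prod_const,
    Finset.prod_const, ← h, pow_mul, Real.sq_sqrt (mul_nonneg (hf 0) (hf 1)), mul_pow,
    show (U.filter fun i => ¬ c i = 1).card = (U.filter fun i => c i = 1).card by omega, mul_comm]

theorem card_halfOnes {ι : Type*} [Fintype ι] [DecidableEq ι] (U : Finset ι) {m l : ℕ}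
    (hm : U.card = 2 * m) (hl : Uᶜ.card = 2 * l) :
    m.centralBinom * l.centralBinom ≤
      (Finset.univ.filter fun c : ι → ZMod 2 => HalfOnes U c ∧ HalfOnes Uᶜ c).card := by
  have hcard : m.centralBinom * l.centralBinom =
      (Finset.powersetCard m U ×ˢ Finset.powersetCard l Uᶜ).card := by
    rw [Finset.card_product, Finset.card_powersetCard, Finset.card_powersetCard, hm, hl]; rfl
  rw [hcard]
  refine Finset.card_le_card_of_injOn
    (fun A i => if i ∈ A.1 ∪ A.2 then 1 else 0) ?_ ?_
  · rintro ⟨A, B⟩ h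
    simp only [Finset.coe_product, Set.mem_prod, Finset.mem_coe, Finset.mem_powersetCard] at h
    obtain ⟨⟨hA, hA'⟩, hB, hB'⟩ := h
    have hB1 : ∀ i ∈ B, i ∉ U := fun i hi => Finset.mem_compl.1 (hB hi)
    rw [Finset.mem_coe, Finset.mem_filter]
    unfold HalfOnes
    have e1 : (U.filter fun i => (if i ∈ A ∪ B then (1 : ZMod 2) else 0) = 1) = A := by
      ext i
      have := @hA i
      have := hB1 i
      by_cases hi : i ∈ A <;> by_cases hi' : i ∈ B <;> simp [hi, hi'] <;> tauto
    have e2 : (Uᶜ.filter fun i => (if i ∈ A ∪ B then (1 : ZMod 2) else 0) = 1) = B := by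
      ext i
      have := @hA i
      have := hB1 i
      by_cases hi : i ∈ A <;> by_cases hi' : i ∈ B <;> simp [hi, hi'] <;> tauto
    exact ⟨Finset.mem_univ _, by rw [e1]; omega, by rw [e2]; omega⟩
  · rintro ⟨A, B⟩ h ⟨A', B'⟩ h' heq
    simp only [Finset.coe_product, Set.mem_prod, Finset.mem_coe, Finset.mem_powersetCard] at h h'
    have hi : ∀ i, i ∈ A ∪ B ↔ i ∈ A' ∪ B' := fun i => by
      have := congrFun heq i
      by_cases h1 : i ∈ A ∪ B <;> by_cases h2 : i ∈ A' ∪ B' <;> simp_all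
    have a1 : ∀ i ∈ B, i ∉ U := fun i hi => Finset.mem_compl.1 (h.2.1 hi)
    have a2 : ∀ i ∈ B', i ∉ U := fun i hi => Finset.mem_compl.1 (h'.2.1 hi)
    have a3 := h.1.1
    have a4 := h'.1.1
    simp only [Finset.mem_union] at hi
    refine Prod.ext (Finset.ext fun i => ?_) (Finset.ext fun i => ?_)
    all_goals
      have := hi i
      have := a1 i
      have := a2 i
      have := @a3 i
      have := @a4 i
      simp only
      tauto

/-- Central binomial coefficients satisfy `4 ^ m ≤ (2 m + 1) * m.centralBinom`, so insisting on
exact balance in both parts costs only a polynomial factor. -/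
theorem four_pow_le_card_halfOnes {ι : Type*} [Fintype ι] [DecidableEq ι] (U : Finset ι)
    (hn : Even (Fintype.card ι)) (hU : Even U.card) :
    (2 : ℝ) ^ Fintype.card ι / (Fintype.card ι + 1) ^ 2 ≤
      ((Finset.univ.filter fun c : ι → ZMod 2 => HalfOnes U c ∧ HalfOnes Uᶜ c).card : ℝ) := by
  obtain ⟨m, hm⟩ := hU
  obtain ⟨n, hn⟩ := hn
  have hc := Finset.card_add_card_compl U
  set k := Fintype.card ι
  have hm : U.card = 2 * m := by omega
  have hl : Uᶜ.card = 2 * (n - m) := by omega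
  have h1 := card_halfOnes U hm hl
  set l := n - m
  have h2 := Nat.four_pow_le_two_mul_add_one_mul_central_binom m
  have h3 := Nat.four_pow_le_two_mul_add_one_mul_central_binom l
  have h4 : 2 ^ k ≤ (k + 1) ^ 2 * (m.centralBinom * l.centralBinom) := by
    calc 2 ^ k = 4 ^ m * 4 ^ l := by
          rw [show k = 2 * (m + l) by omega, pow_mul, pow_add]; norm_num
      _ ≤ ((2 * m + 1) * m.centralBinom) * ((2 * l + 1) * l.centralBinom) := Nat.mul_le_mul h2 h3
      _ = ((2 * m + 1) * (2 * l + 1)) * (m.centralBinom * l.centralBinom) := by ring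
      _ ≤ _ := by
        refine Nat.mul_le_mul_right _ ?_
        rw [pow_two]
        exact Nat.mul_le_mul (by omega) (by omega)
  rw [div_le_iff₀ (by positivity), mul_comm]
  calc (2 : ℝ) ^ k ≤ (k + 1) ^ 2 * (m.centralBinom * l.centralBinom : ℕ) := by exact_mod_cast h4
    _ ≤ _ := by
      refine mul_le_mul_of_nonneg_left ?_ (by positivity)
      exact_mod_cast h1

theorem sum_prod_pi {ι α : Type*} [Fintype ι] [DecidableEq ι] [Fintype α] (f : α → ℝ) :
    ∑ s : ι → α, ∏ i, f (s i) = (∑ a, f a) ^ Fintype.card ι := by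
  have := Finset.prod_univ_sum (fun _ : ι => (Finset.univ : Finset α)) (fun _ b => f b)
  rw [Fintype.piFinset_univ] at this
  rw [← this, Finset.prod_const, Finset.card_univ]

/-- The indicator of evenness is the average of `1` and a sign that factors over the coordinates.
The signed sum is an even power, hence nonnegative. -/
theorem half_pow_le_sum_even {α : Type*} [Fintype α] [DecidableEq α] [Zero α] (G : α → ℝ) {n : ℕ}
    (hn : Even n) :
    (∑ a, G a) ^ n / 2 ≤
      ∑ s : Fin n → α, if Even (Finset.univ.filter fun i => s i = 0).card then ∏ i, G (s i) else 0 := by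
  have h1 := sum_prod_pi (ι := Fin n) G
  have h2 := sum_prod_pi (ι := Fin n) (fun a => (if a = 0 then -1 else 1) * G a)
  rw [Fintype.card_fin] at h1 h2
  have h3 := hn.pow_nonneg (∑ a, (if a = 0 then -1 else 1) * G a)
  rw [← h2] at h3
  have h4 : ∑ s : Fin n → α, (if Even (Finset.univ.filter fun i => s i = 0).card
      then ∏ i, G (s i) else 0) = (∑ s : Fin n → α, ∏ i, G (s i) +
        ∑ s : Fin n → α, ∏ i, (if s i = 0 then -1 else 1) * G (s i)) / 2 := by
    rw [← Finset.sum_add_distrib, Finset.sum_div]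
    refine Finset.sum_congr rfl fun s _ => ?_
    rw [Finset.prod_mul_distrib, Finset.prod_ite, Finset.prod_const, Finset.prod_const_one]
    split_ifs with h
    · rw [h.neg_one_pow]; ring
    · rw [(Nat.not_even_iff_odd.1 h).neg_one_pow]; ring
  rw [h4, ← h1]
  linarith

/-! ### A chain of four-edge blocks -/

/-- The internal syndrome of a block consisting of a direct edge `x 0` and a detour `x 1, x 2, x 3`. -/
def blockSyn (x : Fin 4 → ZMod 2) : ZMod 2 × ZMod 2 := (x 1 + x 2, x 2 + x 3)

/-- The homology class of the error in a block, normalised so that class `0` is the more likely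
one. -/
def blockClass (x : Fin 4 → ZMod 2) : ZMod 2 := x 0 + (x 1 * x 2 + x 2 * x 3 + x 1 * x 3)

/-- The edges of a tube: two end edges and `n` blocks. -/
abbrev TubeEdge (n : ℕ) : Type := Fin 2 ⊕ Fin n × Fin 4

/-- The syndromes and classes of the blocks of a tube. -/
def blockKey {n : ℕ} (t : TubeEdge n → ZMod 2) (i : Fin n) : (ZMod 2 × ZMod 2) × ZMod 2 :=
  (blockSyn fun j => t (.inr (i, j)), blockClass fun j => t (.inr (i, j)))

/-- Two errors on a tube with the same syndrome and opposite homology class. -/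
def TubeOpp {n : ℕ} (t t' : TubeEdge n → ZMod 2) : Prop :=
  (∀ a, t' (.inl a) = t (.inl a) + 1) ∧
    ∀ i, blockKey t' i = ((blockKey t i).1, (blockKey t i).2 + 1)

/-- Blocks with trivial syndrome. -/
def trivialBlocks {n : ℕ} (s : Fin n → ZMod 2 × ZMod 2) : Finset (Fin n) :=
  Finset.univ.filter fun i => s i = 0

/-- Half of the blocks of each kind have class one. -/
def Balanced {n : ℕ} (s : Fin n → ZMod 2 × ZMod 2) (c : Fin n → ZMod 2) : Prop :=
  HalfOnes (trivialBlocks s) c ∧ HalfOnes (trivialBlocks s)ᶜ c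

instance {n : ℕ} (s : Fin n → ZMod 2 × ZMod 2) (c : Fin n → ZMod 2) : Decidable (Balanced s c) :=
  inferInstanceAs (Decidable (_ ∧ _))

theorem balanced_add_one {n : ℕ} {s : Fin n → ZMod 2 × ZMod 2} {c : Fin n → ZMod 2} :
    Balanced s (c + 1) ↔ Balanced s c := by
  refine ⟨fun h => ?_, fun h => ⟨h.1.add_one, h.2.add_one⟩⟩
  have hc : c + 1 + 1 = c := by
    funext i
    have : ∀ b : ZMod 2, b + 1 + 1 = b := by decide
    exact this (c i)
  exact hc ▸ (⟨h.1.add_one, h.2.add_one⟩ : Balanced s (c + 1 + 1))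

/-- The probability that a block has trivial syndrome and class `c`. -/
def trivialProb (p : ℝ) (c : ZMod 2) : ℝ :=
  if c = 1 then p * (1 - p) * ((1 - p) ^ 2 + p ^ 2) else (1 - p) ^ 4 + p ^ 4

/-- The probability that a block has a given nontrivial syndrome and class `c`. -/
def nontrivialProb (p : ℝ) (c : ZMod 2) : ℝ :=
  if c = 1 then 2 * p ^ 2 * (1 - p) ^ 2 else p * (1 - p) * ((1 - p) ^ 2 + p ^ 2)

/-- The probability that a block has syndrome `k.1` and class `k.2`. -/
def blockProb (p : ℝ) (k : (ZMod 2 × ZMod 2) × ZMod 2) : ℝ :=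
  if k.1 = 0 then trivialProb p k.2 else nontrivialProb p k.2

/-- Quadruples as functions. -/
def finFourArrowEquiv : ZMod 2 × ZMod 2 × ZMod 2 × ZMod 2 ≃ (Fin 4 → ZMod 2) where
  toFun a := ![a.1, a.2.1, a.2.2.1, a.2.2.2]
  invFun x := (x 0, x 1, x 2, x 3)
  left_inv _ := rfl
  right_inv x := by ext i; fin_cases i <;> rfl

/-- The second class term is the majority of the detour bits, so complementing all four bits fixes
both syndrome and class. Each of the eight fibres is a pair of complementary strings, which gives
the two-term probabilities. -/
theorem sum_block (p : ℝ) (k : (ZMod 2 × ZMod 2) × ZMod 2) :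
    ∑ x : Fin 4 → ZMod 2 with (blockSyn x, blockClass x) = k, ∏ j, bern p (x j) =
      blockProb p k := by
  have hprod : ∀ a b c d, ∏ j, bern p (finFourArrowEquiv (a, b, c, d) j) =
      bern p a * bern p b * bern p c * bern p d := fun a b c d => Fin.prod_univ_four _
  have hsyn : ∀ a b c d, blockSyn (finFourArrowEquiv (a, b, c, d)) = (b + c, c + d) :=
    fun a b c d => rfl
  have hclass : ∀ a b c d, blockClass (finFourArrowEquiv (a, b, c, d)) =
    a + (b * c + c * d + b * d) := fun a b c d => rfl
  rw [Finset.sum_filter, ← finFourArrowEquiv.sum_comp]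
  obtain ⟨⟨a, b⟩, c⟩ := k
  have h11 : (1 : ZMod 2) + 1 = 0 := by decide
  simp only [Fintype.sum_prod_type, sum_zmod_two, hprod, hsyn, hclass, bern_zero, bern_one, h11,
    add_zero, zero_add, mul_zero, mul_one, blockProb, trivialProb, nontrivialProb, Prod.mk.injEq,
    Prod.mk_eq_zero]
  revert a b c
  simp only [forall_zmod_two, zero_ne_one, one_ne_zero, and_true, and_false, if_true, if_false,
    add_zero, zero_add]
  refine ⟨⟨⟨?_, ?_⟩, ?_, ?_⟩, ⟨?_, ?_⟩, ?_, ?_⟩ <;> ring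

/-- The weight of balanced errors on a tube, with the end edges replaced by `p`. -/
def tubeWeight (p : ℝ) {n : ℕ} (t : TubeEdge n → ZMod 2) : ℝ :=
  p ^ 2 * if Balanced (fun i => (blockKey t i).1) (fun i => (blockKey t i).2) then
    ∏ i : Fin n, ∏ j : Fin 4, bern p (t (.inr (i, j))) else 0

/-- The syndrome and class data of an error on a tube. -/
def tubeKey {n : ℕ} (t : TubeEdge n → ZMod 2) :
    (Fin 2 → ZMod 2) × (Fin n → (ZMod 2 × ZMod 2) × ZMod 2) :=
  (fun a => t (.inl a), blockKey t)

/-- Reversal of the homology class. -/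
def flipKey {n : ℕ} (k : (Fin 2 → ZMod 2) × (Fin n → (ZMod 2 × ZMod 2) × ZMod 2)) :
    (Fin 2 → ZMod 2) × (Fin n → (ZMod 2 × ZMod 2) × ZMod 2) :=
  (k.1 + 1, fun i => ((k.2 i).1, (k.2 i).2 + 1))

theorem flipKey_involutive {n : ℕ} : Function.Involutive (flipKey (n := n)) := by
  rintro ⟨C, k⟩
  have h : ∀ b : ZMod 2, b + 1 + 1 = b := by decide
  refine Prod.ext ?_ ?_
  · funext a; exact h _
  · funext i; exact Prod.ext rfl (h _)

/-- The parts of an error on a tube. -/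
def tubeEquiv (n : ℕ) : (Fin 2 → ZMod 2) × (Fin n → Fin 4 → ZMod 2) ≃ (TubeEdge n → ZMod 2) where
  toFun a e := Sum.elim a.1 (fun ij => a.2 ij.1 ij.2) e
  invFun t := (fun a => t (.inl a), fun i j => t (.inr (i, j)))
  left_inv _ := rfl
  right_inv t := by ext e; rcases e with e | e <;> rfl

/-- Balance depends on the key only, and a fibre is the product of the fibres of the blocks. -/
theorem sum_tubeWeight_fiber (p : ℝ) {n : ℕ}
    (k : (Fin 2 → ZMod 2) × (Fin n → (ZMod 2 × ZMod 2) × ZMod 2)) :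
    ∑ t with tubeKey t = k, tubeWeight p t =
      p ^ 2 * if Balanced (fun i => (k.2 i).1) (fun i => (k.2 i).2) then
        ∏ i, blockProb p (k.2 i) else 0 := by
  obtain ⟨C, k⟩ := k
  have h1 : ∑ t with tubeKey t = (C, k), tubeWeight p t =
      ∑ t with tubeKey t = (C, k), p ^ 2 *
        if Balanced (fun i => (k i).1) (fun i => (k i).2) then
          ∏ i : Fin n, ∏ j : Fin 4, bern p (t (.inr (i, j))) else 0 := by
    refine Finset.sum_congr rfl fun t ht => ?_
    have hk : blockKey t = k := congrArg Prod.snd (Finset.mem_filter.1 ht).2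
    rw [tubeWeight, hk]
  rw [h1, ← Finset.mul_sum]
  congr 1
  dsimp only
  split_ifs with hB
  · have h2 : ∀ i, blockProb p (k i) =
        ∑ x ∈ Finset.univ.filter (fun x : Fin 4 → ZMod 2 => (blockSyn x, blockClass x) = k i),
          ∏ j, bern p (x j) := fun i => (sum_block p _).symm
    simp only [h2]
    rw [Finset.prod_univ_sum, Finset.sum_filter, ← (tubeEquiv n).sum_comp, Fintype.sum_prod_type,
      Finset.sum_eq_single C]
    · rw [← Finset.sum_filter]
      refine Finset.sum_congr ?_ fun _ _ => rfl
      ext g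
      simp only [Finset.mem_filter, Finset.mem_univ, true_and, Fintype.mem_piFinset]
      constructor
      · intro h i
        exact congrFun (congrArg Prod.snd h) i
      · intro h
        exact Prod.ext rfl (funext h)
    · intro C' _ hC
      refine Finset.sum_eq_zero fun g _ => if_neg fun h => hC ?_
      exact congrArg Prod.fst h
    · simp
  · simp

/-- The geometric mean of the probabilities of the two classes of a block with syndrome `s`. -/
def blockMean (p : ℝ) (s : ZMod 2 × ZMod 2) : ℝ :=
  if s = 0 then √(trivialProb p 0 * trivialProb p 1)
    else √(nontrivialProb p 0 * nontrivialProb p 1)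

/-- The three nontrivial syndromes share the same pair of class probabilities. This is why balance
is required only within two kinds of blocks. -/
theorem prod_blockProb_of_balanced {p : ℝ} (hp₀ : 0 ≤ p) (hp : p ≤ 1) {n : ℕ}
    {s : Fin n → ZMod 2 × ZMod 2} {c : Fin n → ZMod 2} (h : Balanced s c) :
    ∏ i, blockProb p (s i, c i) = ∏ i, blockMean p (s i) := by
  have hq : 0 ≤ 1 - p := by linarith
  have h0 : ∀ b, 0 ≤ trivialProb p b := fun b => by unfold trivialProb; split_ifs <;> positivity
  have h1 : ∀ b, 0 ≤ nontrivialProb p b := fun b => by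
    unfold nontrivialProb; split_ifs <;> positivity
  rw [← Finset.prod_mul_prod_compl (trivialBlocks s),
    ← Finset.prod_mul_prod_compl (trivialBlocks s) fun i => blockMean p (s i)]
  congr 1
  · rw [Finset.prod_congr rfl fun i hi => ?_, h.1.prod_eq h0, ← Finset.prod_const]
    · refine Finset.prod_congr rfl fun i hi => ?_
      rw [blockMean, if_pos (Finset.mem_filter.1 hi).2]
    · rw [blockProb, if_pos (Finset.mem_filter.1 hi).2]
  · have hne : ∀ i ∈ (trivialBlocks s)ᶜ, s i ≠ 0 := fun i hi h =>
      Finset.mem_compl.1 hi (Finset.mem_filter.2 ⟨Finset.mem_univ _, h⟩)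
    rw [Finset.prod_congr rfl fun i hi => ?_, h.2.prod_eq h1, ← Finset.prod_const]
    · refine Finset.prod_congr rfl fun i hi => ?_
      rw [blockMean, if_neg (hne i hi)]
    · rw [blockProb, if_neg (hne i hi)]

/-- The Bhattacharyya coefficient of a block. -/
def blockRate (p : ℝ) : ℝ :=
  2 * (√(trivialProb p 0 * trivialProb p 1) + 3 * √(nontrivialProb p 0 * nontrivialProb p 1))

theorem sum_blockMean (p : ℝ) : 2 * ∑ s, blockMean p s = blockRate p := by
  rw [Fintype.sum_prod_type]
  simp only [sum_zmod_two, blockMean, blockRate, Prod.mk_eq_zero, one_ne_zero,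
    and_true, and_false, if_true, if_false]
  ring

/-- The four values of the end bits contribute `4 p ^ 2`. The restriction to an even number of
trivial blocks, without which exact balance is impossible, costs `1 / 2`, and balance itself costs
`(n + 1) ^ 2`. The `2 ^ n` class patterns supply the factor `2` in `blockRate`. -/
theorem le_sum_tubeWeight {p : ℝ} (hp₀ : 0 ≤ p) (hp : p ≤ 1) {n : ℕ} (hn : Even n) :
    2 * p ^ 2 * blockRate p ^ n / (n + 1) ^ 2 ≤ ∑ t : TubeEdge n → ZMod 2, tubeWeight p t := by
  have hG : ∀ s, 0 ≤ blockMean p s := fun s => by unfold blockMean; split_ifs <;> positivity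
  rw [← Finset.sum_fiberwise (s := Finset.univ) (g := tubeKey)]
  simp only [sum_tubeWeight_fiber]
  rw [Fintype.sum_prod_type]
  simp only [Finset.sum_const, Finset.card_univ, Fintype.card_fun, ZMod.card, Fintype.card_fin,
    ← Finset.mul_sum]
  rw [← (Equiv.arrowProdEquivProdArrow (Fin n) (fun _ => ZMod 2 × ZMod 2)
    (fun _ => ZMod 2)).symm.sum_comp, Fintype.sum_prod_type]
  have h1 : ∀ s : Fin n → ZMod 2 × ZMod 2, (2 ^ n / (n + 1) ^ 2) *
      (if Even (Finset.univ.filter fun i => s i = 0).card then ∏ i, blockMean p (s i) else 0) ≤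
        ∑ c : Fin n → ZMod 2, if Balanced s c then ∏ i, blockProb p (s i, c i) else 0 := by
    intro s
    have e : ∑ c : Fin n → ZMod 2, (if Balanced s c then ∏ i, blockProb p (s i, c i) else 0) =
        (Finset.univ.filter fun c : Fin n → ZMod 2 => Balanced s c).card *
          ∏ i, blockMean p (s i) := by
      rw [← Finset.sum_filter, ← nsmul_eq_mul, ← Finset.sum_const]
      exact Finset.sum_congr rfl fun c hc =>
        prod_blockProb_of_balanced hp₀ hp (Finset.mem_filter.1 hc).2
    rw [e]
    split_ifs with hs
    · refine mul_le_mul_of_nonneg_right ?_ (Finset.prod_nonneg fun i _ => hG _)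
      have := four_pow_le_card_halfOnes (trivialBlocks s) (by rwa [Fintype.card_fin]) hs
      rw [Fintype.card_fin] at this
      exact this
    · rw [mul_zero]
      exact mul_nonneg (Nat.cast_nonneg _) (Finset.prod_nonneg fun i _ => hG _)
  have h2 := half_pow_le_sum_even (blockMean p) hn
  have h3 := Finset.sum_le_sum fun s (_ : s ∈ Finset.univ) => h1 s
  rw [← Finset.mul_sum] at h3
  have h4 : (2 : ℝ) ^ n / (n + 1) ^ 2 * ((∑ a, blockMean p a) ^ n / 2) ≤ _ :=
    (mul_le_mul_of_nonneg_left h2 (by positivity)).trans h3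
  have h5 := mul_le_mul_of_nonneg_left h4 (by positivity : (0 : ℝ) ≤ 4 * p ^ 2)
  rw [← sum_blockMean]
  calc _ = 4 * p ^ 2 * ((2 : ℝ) ^ n / (n + 1) ^ 2 * ((∑ a, blockMean p a) ^ n / 2)) := by
        rw [mul_pow]; ring
    _ ≤ _ := h5
    _ = _ := by
      rw [nsmul_eq_mul]
      push_cast
      norm_num
      exact mul_assoc _ _ _

theorem tubeWeight_nonneg {p : ℝ} (hp₀ : 0 ≤ p) (hp : p ≤ 1 / 2) {n : ℕ}
    (t : TubeEdge n → ZMod 2) : 0 ≤ tubeWeight p t := by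
  unfold tubeWeight
  split_ifs
  · exact mul_nonneg (by positivity) (Finset.prod_nonneg fun i _ => Finset.prod_nonneg fun j _ =>
      hp₀.trans (le_bern hp _))
  · simp

theorem tubeWeight_le {p : ℝ} (hp₀ : 0 ≤ p) (hp : p ≤ 1 / 2) {n : ℕ}
    (t : TubeEdge n → ZMod 2) : tubeWeight p t ≤ ∏ e, bern p (t e) := by
  have h0 : ∀ b, 0 ≤ bern p b := fun b => hp₀.trans (le_bern hp b)
  have h1 : 0 ≤ ∏ i : Fin n, ∏ j : Fin 4, bern p (t (.inr (i, j))) :=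
    Finset.prod_nonneg fun i _ => Finset.prod_nonneg fun j _ => h0 _
  rw [Fintype.prod_sum_type, Fintype.prod_prod_type, Fin.prod_univ_two, tubeWeight, pow_two]
  refine mul_le_mul (mul_le_mul (le_bern hp _) (le_bern hp _) hp₀ (h0 _)) ?_ ?_
    (mul_nonneg (h0 _) (h0 _))
  · split_ifs
    exacts [le_rfl, h1]
  · split_ifs
    exacts [h1, le_rfl]

open scoped Classical in
/-- Failure of any decoder for `N` parallel tubes. -/
theorem sum_tubes_le {p : ℝ} (hp₀ : 0 < p) (hp : p ≤ 1 / 2) {n : ℕ} (hn : Even n) (N : ℕ)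
    (J : (Fin N → TubeEdge n → ZMod 2) → Prop)
    (hJ : ∀ f j t, TubeOpp (f j) t → J f → ¬ J (Function.update f j t))
    (hN : 1 ≤ N * (2 * p ^ 2 * blockRate p ^ n / (n + 1) ^ 2)) :
    ∑ f, (if J f then ∏ j, ∏ e, bern p (f j e) else 0) ≤ 3 / 4 := by
  set β := ∑ t : TubeEdge n → ZMod 2, tubeWeight p t with hβ
  have hβ1 : β ≤ 1 := by
    rw [hβ, ← sum_prod_bern (ι := TubeEdge n) p]
    exact Finset.sum_le_sum fun t _ => tubeWeight_le hp₀.le hp t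
  have hhalf : ∀ J : (TubeEdge n → ZMod 2) → Prop, (∀ t t', TubeOpp t t' → J t → ¬ J t') →
      ∑ t, (if J t then tubeWeight p t else 0) ≤ β / 2 := fun J hJ => by
    -- `flipKey` reverses the class of every block and keeps the syndromes, so it preserves balance,
    -- and balanced keys with the same syndromes have equal weight.
    refine sum_ite_le_half_of_flip tubeKey flipKey flipKey_involutive (tubeWeight p)
      (tubeWeight_nonneg hp₀.le hp) (fun k => ?_) J fun t t' h => hJ t t' ⟨?_, ?_⟩
    · rw [sum_tubeWeight_fiber, sum_tubeWeight_fiber]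
      have hb : Balanced (fun i => ((flipKey k).2 i).1) (fun i => ((flipKey k).2 i).2) ↔
        Balanced (fun i => (k.2 i).1) (fun i => (k.2 i).2) := balanced_add_one
      congr 1
      by_cases h : Balanced (fun i => (k.2 i).1) (fun i => (k.2 i).2)
      · rw [if_pos h, if_pos (hb.2 h)]
        have e1 := prod_blockProb_of_balanced hp₀.le (by linarith : p ≤ 1) h
        have e2 := prod_blockProb_of_balanced hp₀.le (by linarith : p ≤ 1) (hb.2 h)
        exact e2.trans e1.symm
      · rw [if_neg h, if_neg fun h' => h (hb.1 h')]
    · exact fun a => congrFun (congrArg Prod.fst h) a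
    · exact fun i => congrFun (congrArg Prod.snd h) i
  have h1 := sum_prod_le_of_half TubeOpp (fun t => ∏ e, bern p (t e)) (tubeWeight p) β
    (sum_prod_bern p) (tubeWeight_nonneg hp₀.le hp) (tubeWeight_le hp₀.le hp) rfl hhalf N J hJ
  have h2 : 1 ≤ N * β := hN.trans
    (mul_le_mul_of_nonneg_left (le_sum_tubeWeight hp₀.le (by linarith) hn) (Nat.cast_nonneg _))
  linarith [one_sub_pow_le_half hβ1 h2]

/-- The detours of a block compensate for the probability that a direct edge is free of errors. -/
theorem two_mul_sqrt_lt_blockRate {p : ℝ} (hp₀ : 0 < p) (hp : p ≤ 1 / 4)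
    (h : p * (1 - p) < 1 / 8) : 2 * √p < blockRate p := by
  -- The smaller root of `p (1 - p) = 1 / 8` is `(1 - 1 / √2) / 2 ≈ 0.14645`; the bound `p ≤ 1 / 4`
  -- excludes the larger one.
  have hp1 : p < 0.1465 := by nlinarith
  set t := p * (1 - p) with ht
  have ht0 : 0 < t := mul_pos hp₀ (by linarith)
  have e1 : trivialProb p 0 * trivialProb p 1 = p * ((1 - p) * (1 - 2 * t) * (1 - 4 * t + 2 * t ^ 2)) := by
    simp [trivialProb, ht]; ring
  have e2 : nontrivialProb p 0 * nontrivialProb p 1 = p * ((1 - p) * (1 - 2 * t) * (2 * t ^ 2)) := by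
    simp [nontrivialProb, ht]; ring
  have hD : 0 ≤ (1 - p) * (1 - 2 * t) := mul_nonneg (by linarith) (by linarith)
  rw [blockRate, e1, e2, Real.sqrt_mul hp₀.le, Real.sqrt_mul hp₀.le, Real.sqrt_mul hD,
    Real.sqrt_mul hD]
  -- After division by `2√p` the claim is `1 < S (√(1 - 4t + 2t²) + 3√2 t)`. To first order `S`
  -- loses `3p/2` and the first root loses `2p`, while the nontrivial syndromes gain `3√2 p ≈ 4.24
  -- p`. The decimals below make this rigorous on the whole range.
  have h1 : 1 - 2 * t - 1.5 * t ^ 2 ≤ √(1 - 4 * t + 2 * t ^ 2) := by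
    refine Real.le_sqrt_of_sq_le ?_
    have : 0 ≤ t ^ 2 * (1 - 6 * t - 2.25 * t ^ 2) := mul_nonneg (sq_nonneg _) (by nlinarith)
    nlinarith
  have h2 : 1.4134 * t ≤ √(2 * t ^ 2) := by
    refine Real.le_sqrt_of_sq_le ?_
    nlinarith [sq_nonneg t]
  set S := √((1 - p) * (1 - 2 * t)) with hS
  have hS0 : 0 ≤ S := Real.sqrt_nonneg _
  have h3 : 1 < S * (1 + 2.24 * t - 1.5 * t ^ 2) := by
    have hb : 0 < 1 + 2.24 * t - 1.5 * t ^ 2 := by nlinarith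
    have : 1 < (S * (1 + 2.24 * t - 1.5 * t ^ 2)) ^ 2 := by
      rw [mul_pow, hS, Real.sq_sqrt hD]
      have k1 : 0.728 ≤ (1 - p) ^ 2 := by nlinarith
      have k2 : 1.44 ≤ 2.48 - 6.95 * t - 10.76 * t ^ 2 := by nlinarith
      have k3 : 1 < (1 - p) ^ 2 * (2.48 - 6.95 * t - 10.76 * t ^ 2) := by nlinarith
      -- Since `t = p (1 - p)`, the right side minus `1` equals `p` times the difference of the two
      -- sides in `k3`.
      have k4 : 1 < (1 - p) * (1 + 2.48 * t - 6.95 * t ^ 2 - 10.76 * t ^ 3) := by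
        have := mul_lt_mul_of_pos_left k3 hp₀
        rw [ht] at this ⊢
        nlinarith
      have k5 : 1 + 2.48 * t - 6.95 * t ^ 2 - 10.76 * t ^ 3 ≤
          (1 - 2 * t) * (1 + 2.24 * t - 1.5 * t ^ 2) ^ 2 := by
        have : 0 ≤ t ^ 2 * (0.0076 + 0.0048 * t + 15.69 * t ^ 2 - 4.5 * t ^ 3) := by
          refine mul_nonneg (sq_nonneg _) ?_
          have : 0 ≤ t ^ 2 * (15.69 - 4.5 * t) := mul_nonneg (sq_nonneg _) (by linarith)
          nlinarith
        nlinarith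
      calc 1 < _ := k4
        _ ≤ _ := mul_le_mul_of_nonneg_left k5 (by linarith)
        _ = _ := by ring
    nlinarith [mul_nonneg hS0 hb.le]
  have h4 : 1 < S * √(1 - 4 * t + 2 * t ^ 2) + 3 * (S * √(2 * t ^ 2)) := by
    nlinarith
  have := mul_lt_mul_of_pos_left h4 (Real.sqrt_pos.2 hp₀)
  linarith

/-! ### Unitarity -/

theorem tensorOp_mul {ι : Type} [Fintype ι] [DecidableEq ι] (A B : ι → Matrix (ZMod 2) (ZMod 2) ℂ) :
    tensorOp A * tensorOp B = tensorOp fun i => A i * B i := by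
  ext b b'
  simp only [tensorOp, Matrix.mul_apply, Matrix.of_apply, ← Finset.prod_mul_distrib]
  rw [Finset.prod_univ_sum, Fintype.piFinset_univ]

theorem tensorOp_one {ι : Type} [Fintype ι] [DecidableEq ι] :
    tensorOp (fun _ : ι => (1 : Matrix (ZMod 2) (ZMod 2) ℂ)) = 1 := by
  ext b b'
  simp only [tensorOp, Matrix.of_apply, Matrix.one_apply]
  rw [Finset.prod_ite_zero, Finset.prod_const_one]
  simp [funext_iff]

theorem tensorOp_conjTranspose {ι : Type} [Fintype ι] (A : ι → Matrix (ZMod 2) (ZMod 2) ℂ) :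
    (tensorOp A).conjTranspose = tensorOp fun i => (A i).conjTranspose := by
  ext b b'
  simp [tensorOp, Matrix.conjTranspose_apply]

theorem tensorOp_unitary {ι : Type} [Fintype ι] [DecidableEq ι]
    {A : ι → Matrix (ZMod 2) (ZMod 2) ℂ} (hA : ∀ i, (A i).conjTranspose * A i = 1) :
    (tensorOp A).conjTranspose * tensorOp A = 1 := by
  rw [tensorOp_conjTranspose, tensorOp_mul]
  simp only [hA, tensorOp_one]

theorem hadamard_unitary : hadamard.conjTranspose * hadamard = 1 := by
  have h : ((√2 : ℝ) : ℂ) * ((√2 : ℝ) : ℂ) = 2 := by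
    rw [← Complex.ofReal_mul, Real.mul_self_sqrt (by norm_num)]; norm_num
  have h' : ((√2 : ℝ) : ℂ)⁻¹ * ((√2 : ℝ) : ℂ)⁻¹ = 1 / 2 := by
    rw [← mul_inv, h, one_div]
  have v1 : (1 : ZMod 2).val = 1 := rfl
  have key : ∀ a b : ZMod 2, (hadamard.conjTranspose * hadamard) a b =
      (1 : Matrix (ZMod 2) (ZMod 2) ℂ) a b := by
    simp only [forall_zmod_two, Matrix.mul_apply, sum_zmod_two, Matrix.conjTranspose_apply, hadamard,
      Matrix.of_apply, mul_zero, zero_mul, mul_one, ZMod.val_zero, v1, pow_zero, pow_one, star_mul',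
      Complex.star_def, Complex.conj_ofReal, Matrix.one_apply,
      zero_ne_one, one_ne_zero, if_true, if_false, mul_neg]
    norm_num
    rw [h']
    norm_num
  exact Matrix.ext key

theorem pauliX_pow_apply (a b b' : ZMod 2) :
    (pauliX ^ a.val) b b' = if b' = b + a then 1 else 0 := by
  have v1 : (1 : ZMod 2).val = 1 := rfl
  have h11 : (1 : ZMod 2) + 1 = 0 := by decide
  revert a b b'
  simp [forall_zmod_two, v1, h11, pauliX]

theorem pauliX_pow_unitary (a : ZMod 2) :
    (pauliX ^ a.val).conjTranspose * pauliX ^ a.val = 1 := by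
  have h11 : (1 : ZMod 2) + 1 = 0 := by decide
  have key : ∀ a b c : ZMod 2, ((pauliX ^ a.val).conjTranspose * pauliX ^ a.val) b c =
      (1 : Matrix (ZMod 2) (ZMod 2) ℂ) b c := by
    intro a b c
    simp only [Matrix.mul_apply, Matrix.conjTranspose_apply, pauliX_pow_apply, sum_zmod_two,
      Matrix.one_apply]
    revert a b c
    simp [forall_zmod_two, h11]
  exact Matrix.ext (key a)

theorem hadamardOn_unitary (d R : ℕ) (Ω : Finset Site) :
    (hadamardOn d R Ω).conjTranspose * hadamardOn d R Ω = 1 := by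
  refine tensorOp_unitary fun c => ?_
  split_ifs
  · exact hadamard_unitary
  · simp

theorem bitFlip_unitary (d R : ℕ) (y : Qubit d R → ZMod 2) :
    (bitFlip d R y).conjTranspose * bitFlip d R y = 1 :=
  tensorOp_unitary fun c => pauliX_pow_unitary (y c)

theorem prodCZ_unitary (d R : ℕ) : (prodCZ d R).conjTranspose * prodCZ d R = 1 := by
  rw [prodCZ, Matrix.diagonal_conjTranspose, Matrix.diagonal_mul_diagonal, ← Matrix.diagonal_one]
  congr 1
  funext b
  rw [Pi.star_apply, star_prod, ← Finset.prod_mul_distrib]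
  refine Finset.prod_eq_one fun e _ => ?_
  split_ifs <;> simp

theorem sum_norm_sq_mulVec {ι : Type*} [Fintype ι] [DecidableEq ι] {U : Matrix ι ι ℂ}
    (hU : U.conjTranspose * U = 1) (v : ι → ℂ) :
    ∑ i, ‖U.mulVec v i‖ ^ 2 = ∑ i, ‖v i‖ ^ 2 := by
  have h : ∀ w : ι → ℂ, ((∑ i, ‖w i‖ ^ 2 : ℝ) : ℂ) = dotProduct (star w) w := fun w => by
    push_cast
    refine Finset.sum_congr rfl fun i _ => ?_
    rw [Pi.star_apply, Complex.star_def, Complex.conj_mul']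
  have : ((∑ i, ‖U.mulVec v i‖ ^ 2 : ℝ) : ℂ) = ((∑ i, ‖v i‖ ^ 2 : ℝ) : ℂ) := by
    rw [h, h, Matrix.star_mulVec, ← Matrix.dotProduct_mulVec, Matrix.mulVec_mulVec, hU,
      Matrix.one_mulVec]
  exact_mod_cast this

theorem sum_norm_sq_final (d R : ℕ) (y : Qubit d R → ZMod 2) (Ω : Finset Site) :
    ∑ b, ‖(hadamardOn d R Ω).mulVec (inputState d R y) b‖ ^ 2 = 1 := by
  rw [sum_norm_sq_mulVec (hadamardOn_unitary d R Ω), inputState,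
    sum_norm_sq_mulVec (bitFlip_unitary d R y), circuitW, ← Matrix.mulVec_mulVec,
    ← Matrix.mulVec_mulVec, sum_norm_sq_mulVec (hadamardOn_unitary d R _),
    sum_norm_sq_mulVec (prodCZ_unitary d R), sum_norm_sq_mulVec (hadamardOn_unitary d R _),
    Finset.sum_eq_single 0]
  · simp
  · intro b _ hb
    simp [Pi.single_eq_of_ne hb]
  · simp

/-! ### Shifting the error and the outcomes -/

theorem q₁_mem_qubits {d R : ℕ} (hd : 1 ≤ d) (hR : 1 ≤ R) : q₁ ∈ qubits d R := by
  simp only [q₁, qubits, Finset.mem_filter, Finset.mem_product, Finset.mem_Icc]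
  refine ⟨⟨⟨?_, ?_⟩, ⟨?_, ?_⟩, ?_, ?_⟩, ?_, ?_⟩ <;> first | omega | simp

theorem q₂_mem_qubits {d R : ℕ} (hd : 1 ≤ d) (hR : 1 ≤ R) : q₂ R ∈ qubits d R := by
  simp only [q₂, qubits, Finset.mem_filter, Finset.mem_product, Finset.mem_Icc]
  refine ⟨⟨⟨?_, ?_⟩, ⟨?_, ?_⟩, ?_, ?_⟩, ?_, ?_⟩ <;> first | omega | simp

theorem q₁_ne_q₂ {R : ℕ} (hR : 3 ≤ R) : q₁ ≠ q₂ R := by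
  simp only [q₁, q₂, ne_eq, Prod.mk.injEq, true_and]
  omega

/-- The restriction of a bit string to the measured qubits. -/
def toOutcome {d R : ℕ} (y : Qubit d R → ZMod 2) : Outcome d R :=
  fun c => y ⟨c.1, (Finset.mem_sdiff.1 c.2).1⟩

/-- The value of a bit string at a site, zero outside the cluster lattice. -/
def bitAt {d R : ℕ} (y : Qubit d R → ZMod 2) (s : Site) : ZMod 2 :=
  if h : s ∈ qubits d R then y ⟨s, h⟩ else 0

theorem toOutcome_apply {d R : ℕ} (y : Qubit d R → ZMod 2) (c : measured d R) :
    toOutcome y c = bitAt y c.1 := by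
  rw [bitAt, dif_pos (Finset.mem_sdiff.1 c.2).1]; rfl

theorem bitAt_coe {d R : ℕ} (y : Qubit d R → ZMod 2) (c : Qubit d R) : bitAt y c.1 = y c := by
  rw [bitAt, dif_pos c.2]

/-- The bits at the two unmeasured qubits. -/
def endBits {d R : ℕ} (y : Qubit d R → ZMod 2) : ZMod 2 × ZMod 2 := (bitAt y q₁, bitAt y (q₂ R))

theorem glue_add {d R : ℕ} (o : Outcome d R) (t : ZMod 2 × ZMod 2) (δ : Qubit d R → ZMod 2) :
    glue (o + toOutcome δ) (t + endBits δ) = glue o t + δ := by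
  funext c
  simp only [glue, Pi.add_apply]
  split_ifs with h1 h2
  · rfl
  · rw [Prod.fst_add, endBits, ← h2, bitAt_coe]
  · have h3 : c.1 = q₂ R := by
      by_contra h3
      exact h1 (Finset.mem_sdiff.2 ⟨c.2, by simp [h2, h3]⟩)
    rw [Prod.snd_add, endBits, ← h3, bitAt_coe]

theorem glue_injective {d R : ℕ} (hd : 1 ≤ d) (hR : 3 ≤ R) :
    Function.Injective fun a : Outcome d R × (ZMod 2 × ZMod 2) => glue a.1 a.2 := by
  rintro ⟨o, t⟩ ⟨o', t'⟩ h
  have h1 : ∀ c : Qubit d R, glue o t c = glue o' t' c := congrFun h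
  have hq1 := h1 ⟨q₁, q₁_mem_qubits hd (by omega)⟩
  have hq2 := h1 ⟨q₂ R, q₂_mem_qubits hd (by omega)⟩
  have m1 : q₁ ∉ measured d R := by simp [measured]
  have m2 : q₂ R ∉ measured d R := by simp [measured]
  simp only [glue, m1, m2, dif_neg, not_false_eq_true, if_true, (q₁_ne_q₂ hR).symm, if_false]
    at hq1 hq2
  refine Prod.ext (funext fun c => ?_) (Prod.ext hq1 hq2)
  have := h1 ⟨c.1, (Finset.mem_sdiff.1 c.2).1⟩
  simpa only [glue, c.2, dif_pos] using this

/-- The final vector has norm one by unitarity, and distinct pairs of an outcome and end bits give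
distinct basis strings. -/
theorem sum_outcomeProb_le {d R : ℕ} (hd : 1 ≤ d) (hR : 3 ≤ R) (y : Qubit d R → ZMod 2) :
    ∑ o, outcomeProb d R y o ≤ 1 := by
  simp only [outcomeProb]
  rw [← Fintype.sum_prod_type', ← sum_norm_sq_final d R y (setX d R)]
  simp only [postMeasurement]
  rw [← Finset.sum_image (s := Finset.univ)
    (g := fun a : Outcome d R × (ZMod 2 × ZMod 2) => glue a.1 a.2)
    (f := fun b => ‖(hadamardOn d R (setX d R)).mulVec (inputState d R y) b‖ ^ 2)
    fun a _ b _ h => glue_injective hd hR h]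
  exact Finset.sum_le_sum_of_subset_of_nonneg (Finset.subset_univ _) fun _ _ _ => by positivity

theorem outcomeProb_nonneg {d R : ℕ} (y : Qubit d R → ZMod 2) (o : Outcome d R) :
    0 ≤ outcomeProb d R y o := Finset.sum_nonneg fun _ _ => by positivity

theorem bitFlip_mulVec {d R : ℕ} (y b : Qubit d R → ZMod 2) (ψ : (Qubit d R → ZMod 2) → ℂ) :
    (bitFlip d R y).mulVec ψ b = ψ (b + y) := by
  simp only [bitFlip, Matrix.mulVec, dotProduct, tensorOp, Matrix.of_apply, pauliX_pow_apply]
  rw [Finset.sum_eq_single (b + y)]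
  · simp
  · intro b' _ hb'
    obtain ⟨c, hc⟩ := Function.ne_iff.1 hb'
    rw [Finset.prod_eq_zero (Finset.mem_univ c) (if_neg hc), zero_mul]
  · simp

theorem zmod_two_add_self (b : ZMod 2) : b + b = 0 := by revert b; decide

/-- Away from `Ω` the factors are identity matrices, which see only the difference of their indices.
-/
theorem hadamardOn_apply_add {d R : ℕ} {Ω : Finset Site} {δ : Qubit d R → ZMod 2}
    (hδ : ∀ c : Qubit d R, c.1 ∈ Ω → δ c = 0) (b b' : Qubit d R → ZMod 2) :
    hadamardOn d R Ω (b + δ) (b' + δ) = hadamardOn d R Ω b b' := by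
  simp only [hadamardOn, tensorOp, Matrix.of_apply, Pi.add_apply]
  refine Finset.prod_congr rfl fun c _ => ?_
  split_ifs with hc
  · rw [hδ c hc, add_zero, add_zero]
  · simp [Matrix.one_apply]

theorem inputState_add {d R : ℕ} (δ y b : Qubit d R → ZMod 2) :
    inputState d R (y + δ) (b + δ) = inputState d R y b := by
  have h : b + δ + (y + δ) = b + y := by
    funext c
    change b c + δ c + (y c + δ c) = b c + y c
    rw [add_add_add_comm, zmod_two_add_self, add_zero]
  rw [inputState, inputState, bitFlip_mulVec, bitFlip_mulVec, h]

/-- A bit flip on a qubit measured in the `Z`-basis only flips its outcome, and on an unmeasured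
qubit it only shifts the index of the state. -/
theorem postMeasurement_add {d R : ℕ} {δ : Qubit d R → ZMod 2}
    (hδ : ∀ c : Qubit d R, c.1 ∈ setX d R → δ c = 0) (y : Qubit d R → ZMod 2) (o : Outcome d R)
    (t : ZMod 2 × ZMod 2) :
    postMeasurement d R (y + δ) (o + toOutcome δ) (t + endBits δ) = postMeasurement d R y o t := by
  unfold postMeasurement
  rw [glue_add]
  refine (Fintype.sum_equiv (Equiv.addRight δ) _ _ fun b => ?_).symm
  exact (congrArg₂ (· * ·) (hadamardOn_apply_add hδ (glue o t) b) (inputState_add δ y b)).symm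

theorem outcomeProb_add {d R : ℕ} {δ : Qubit d R → ZMod 2}
    (hδ : ∀ c : Qubit d R, c.1 ∈ setX d R → δ c = 0) (y : Qubit d R → ZMod 2) (o : Outcome d R) :
    outcomeProb d R (y + δ) (o + toOutcome δ) = outcomeProb d R y o := by
  simp only [outcomeProb]
  rw [← Equiv.sum_comp (Equiv.addRight (endBits δ))]
  exact Finset.sum_congr rfl fun t _ => by rw [Equiv.coe_addRight, postMeasurement_add hδ]

/-! ### Successful outcomes -/

/-- The protocol returns the Bell state. -/
def Success {d R : ℕ} (gX gZ : Finset Site → ZMod 2) (y : Qubit d R → ZMod 2) (o : Outcome d R) :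
    Prop := SameState (outputState d R gX gZ y o) (bell 0 0)

theorem pauliZX_apply (a b t s : ZMod 2) : (pauliZ ^ a.val * pauliX ^ b.val) t s =
    if s = t + b then (-1) ^ (a * t).val else 0 := by
  have v1 : (1 : ZMod 2).val = 1 := rfl
  rw [Matrix.mul_apply]
  simp only [pauliX_pow_apply, sum_zmod_two]
  revert a b t s
  simp [forall_zmod_two, v1, pauliZ]

theorem outputState_apply {d R : ℕ} (gX gZ : Finset Site → ZMod 2) (y : Qubit d R → ZMod 2)
    (o : Outcome d R) (t s : ZMod 2) : outputState d R gX gZ y o (t, s) =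
      (-1) ^ (correctionX gX o * t).val *
        postMeasurement d R y o (t + correctionZ gZ o, s) := by
  rw [outputState, Matrix.mulVec, dotProduct, Fintype.sum_prod_type]
  simp only [Matrix.kroneckerMap_apply, pauliZX_apply, Matrix.one_apply]
  rw [Finset.sum_eq_single (t + correctionZ gZ o)]
  · simp
  · intro b _ hb
    simp [hb]
  · simp

theorem Success.exists_eq {d R : ℕ} {gX gZ : Finset Site → ZMod 2} {y : Qubit d R → ZMod 2}
    {o : Outcome d R} (h : Success gX gZ y o) :
    ∃ r : ℂ, r ≠ 0 ∧ postMeasurement d R y o (correctionZ gZ o, 0) = r ∧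
      (-1) ^ (correctionX gX o).val * postMeasurement d R y o (1 + correctionZ gZ o, 1) = r ∧
      postMeasurement d R y o (correctionZ gZ o, 1) = 0 ∧
      postMeasurement d R y o (1 + correctionZ gZ o, 0) = 0 := by
  obtain ⟨c, hc, h⟩ := h
  have hb : bell 0 0 = bellPhi := by simp [bell]
  rw [hb] at h
  have key := fun t s => (outputState_apply gX gZ y o t s).symm.trans (congrFun h (t, s))
  have k00 := key 0 0
  have k01 := key 0 1
  have k10 := key 1 0
  have k11 := key 1 1
  simp only [bellPhi, Pi.smul_apply, smul_eq_mul, mul_zero, zero_add, mul_one, ZMod.val_zero,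
    pow_zero, one_mul, zero_ne_one, one_ne_zero, if_true, if_false, mul_eq_zero, pow_eq_zero_iff',
    neg_eq_zero, false_and, false_or] at k00 k01 k10 k11
  refine ⟨_, ?_, k00, k11, k01, k10⟩
  refine mul_ne_zero hc (Complex.ofReal_ne_zero.2 (by positivity))

/-- If `ĉ_Z` is the same, the relative sign of the two surviving amplitudes is wrong. If `ĉ_Z`
differs, the second success needs an amplitude to be nonzero that the first forces to vanish.
Nothing has to be known about the dual decoder. -/
theorem not_success_of_correctionX {d R : ℕ} {gX gZ : Finset Site → ZMod 2}
    {y y' : Qubit d R → ZMod 2} {o o' : Outcome d R}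
    (hφ : postMeasurement d R y' o' = postMeasurement d R y o)
    (hc : correctionX gX o' = correctionX gX o + 1) (h : Success gX gZ y o) :
    ¬ Success gX gZ y' o' := by
  intro h'
  obtain ⟨r, hr, h1, h2, h3, h4⟩ := h.exists_eq
  obtain ⟨r', hr', h1', h2', h3', h4'⟩ := h'.exists_eq
  rw [hφ] at h1' h2' h3' h4'
  have e : ∀ b b' : ZMod 2, b' = b ∨ b' = 1 + b := by decide
  rcases e (correctionZ gZ o) (correctionZ gZ o') with hb | hb
  · rw [hb] at h1' h2'
    have hrr : r' = r := h1'.symm.trans h1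
    have hs : ∀ a : ZMod 2, (-1 : ℂ) ^ (a + 1).val = -(-1) ^ a.val := by
      have v1 : (1 : ZMod 2).val = 1 := rfl
      have h11 : (1 : ZMod 2) + 1 = 0 := by decide
      simp [forall_zmod_two, v1, h11]
    rw [hc, hs, neg_mul, h2, hrr] at h2'
    exact hr (by linear_combination -h2' / 2)
  · rw [hb] at h1'
    exact hr' (h1'.symm.trans h4)

/-- All outcomes, and hence both corrections, are unchanged, while the state is moved to the other
parity of the two qubits. -/
theorem not_success_of_endBits {d R : ℕ} {gX gZ : Finset Site → ZMod 2}
    {y δ : Qubit d R → ZMod 2} {o : Outcome d R} (hδ : toOutcome δ = 0)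
    (hδX : ∀ c : Qubit d R, c.1 ∈ setX d R → δ c = 0)
    (he : (endBits δ).1 + (endBits δ).2 = 1) (h : Success gX gZ y o) :
    ¬ Success gX gZ (y + δ) o := by
  intro h'
  obtain ⟨r, hr, h1, h2, h3, h4⟩ := h.exists_eq
  obtain ⟨r', hr', h1', h2', h3', h4'⟩ := h'.exists_eq
  have hp := fun t => postMeasurement_add hδX y o t
  rw [hδ, add_zero] at hp
  generalize endBits δ = e at he hp
  obtain ⟨e₁, e₂⟩ := e
  have e : ∀ a b : ZMod 2, a + b = 1 → a = 0 ∧ b = 1 ∨ a = 1 ∧ b = 0 := by decide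
  rcases e e₁ e₂ he with ⟨rfl, rfl⟩ | ⟨rfl, rfl⟩
  · have := hp (correctionZ gZ o, 1)
    rw [h3, Prod.mk_add_mk, add_zero, show (1 : ZMod 2) + 1 = 0 by decide, h1'] at this
    exact hr' this
  · have := hp (1 + correctionZ gZ o, 0)
    rw [h4, Prod.mk_add_mk, add_zero, add_comm (1 : ZMod 2), add_assoc,
      show (1 : ZMod 2) + 1 = 0 by decide, add_zero, h1'] at this
    exact hr' this

/-! ### Averaging over the error on a set of qubits -/

/-- The parameter `s` is the error off the range of `ι`; conditionally on it, the bits on `K` are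
still independent. -/
theorem exists_bernoulli_split {K Q : Type} [Fintype K] [Fintype Q] [DecidableEq K]
    [DecidableEq Q] {ι : K → Q} (hι : Function.Injective ι) {p : ℝ} (hp₀ : 0 ≤ p) (hp : p ≤ 1) :
    ∃ (S : Type) (_ : Fintype S) (v : S → ℝ) (base : S → Q → ZMod 2), (∀ s, 0 ≤ v s) ∧
      ∑ s, v s = 1 ∧ ∀ F : (Q → ZMod 2) → ℝ, ∑ y, bernoulliWeight p y * F y =
        ∑ s, v s * ∑ κ : K → ZMod 2, (∏ k, bern p (κ k)) *
          F (base s + Function.extend ι κ 0) := by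
  classical
  let e : K ⊕ {c // c ∉ Set.range ι} ≃ Q :=
    (Equiv.sumCongr (Equiv.ofInjective ι hι) (Equiv.refl _)).trans
      (Equiv.sumCompl (· ∈ Set.range ι))
  have el : ∀ k, e (.inl k) = ι k := fun k => rfl
  have er : ∀ c, e (.inr c) = c.1 := fun c => rfl
  let E : ({c // c ∉ Set.range ι} → ZMod 2) × (K → ZMod 2) ≃ (Q → ZMod 2) :=
    ((Equiv.prodComm _ _).trans (Equiv.sumArrowEquivProdArrow _ _ _).symm).trans
      (e.arrowCongr (Equiv.refl _))
  have hE : ∀ a x, E a (e x) = Sum.elim a.2 a.1 x := fun a x => by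
    simp [E, Equiv.arrowCongr]
    rfl
  refine ⟨{c // c ∉ Set.range ι} → ZMod 2, inferInstance, fun s => ∏ c, bern p (s c),
    fun s => E (s, 0), fun s => Finset.prod_nonneg fun c _ => ?_, sum_prod_bern p, fun F => ?_⟩
  · unfold bern; split_ifs <;> linarith
  · rw [← E.sum_comp, Fintype.sum_prod_type]
    refine Finset.sum_congr rfl fun s _ => ?_
    rw [Finset.mul_sum]
    refine Finset.sum_congr rfl fun κ _ => ?_
    have h1 : bernoulliWeight p (E (s, κ)) = (∏ c, bern p (s c)) * ∏ k, bern p (κ k) := by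
      change ∏ c, bern p (E (s, κ) c) = _
      rw [← e.prod_comp, Fintype.prod_sum_type, mul_comm]
      simp only [hE, Sum.elim_inl, Sum.elim_inr]
    have h2 : E (s, κ) = E (s, 0) + Function.extend ι κ 0 := by
      funext c
      obtain ⟨x, rfl⟩ := e.surjective c
      rw [Pi.add_apply, hE, hE]
      rcases x with k | c
      · rw [el, hι.extend_apply]; simp
      · rw [er, Function.extend_apply' _ _ _ fun ⟨k, hk⟩ => c.2 ⟨k, hk⟩]; simp
    rw [h1, h2, mul_assoc]

theorem extend_add {K Q : Type} {ι : K → Q} (hι : Function.Injective ι) (κ κ' : K → ZMod 2) :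
    Function.extend ι (κ + κ') 0 = Function.extend ι κ 0 + Function.extend ι κ' (0 : Q → ZMod 2) := by
  funext c
  by_cases h : ∃ k, ι k = c
  · obtain ⟨k, rfl⟩ := h
    simp [hι.extend_apply]
  · simp [Function.extend_apply' _ _ _ h]

theorem toOutcome_add {d R : ℕ} (y y' : Qubit d R → ZMod 2) :
    toOutcome (y + y') = toOutcome y + toOutcome y' := rfl

open scoped Classical in
-- The reduction from the quantum protocol to a classical question about subsets `J` of error
-- patterns on `K`. It works conditionally on the error elsewhere and on the outcomes corrected for
-- the error on `K`.
theorem bellProb_le {d R : ℕ} (hd : 1 ≤ d) (hR : 3 ≤ R) {p : ℝ} (hp₀ : 0 ≤ p) (hp : p ≤ 1)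
    (gX gZ : Finset Site → ZMod 2) {K : Type} [Fintype K] [DecidableEq K] {ι : K → Qubit d R}
    (hι : Function.Injective ι) (hX : ∀ k, (ι k).1 ∉ setX d R)
    (opp : (K → ZMod 2) → (K → ZMod 2) → Prop) {B : ℝ}
    (hB : ∀ J : (K → ZMod 2) → Prop, (∀ κ κ', opp κ κ' → J κ → ¬ J κ') →
      ∑ κ, (if J κ then ∏ k, bern p (κ k) else 0) ≤ B)
    (hopp : ∀ κ κ', opp κ κ' → ∀ (y : Qubit d R → ZMod 2) (o : Outcome d R),
      Success gX gZ y o → ¬ Success gX gZ (y + Function.extend ι (κ + κ') 0)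
        (o + toOutcome (Function.extend ι (κ + κ') 0))) :
    bellProb d R p gX gZ 0 0 ≤ B := by
  obtain ⟨S, _, v, base, hv, hv1, hsplit⟩ := exists_bernoulli_split hι hp₀ hp
  have hXδ : ∀ (κ : K → ZMod 2) (c : Qubit d R), c.1 ∈ setX d R →
      Function.extend ι κ 0 c = 0 := fun κ c hc => by
    rw [Function.extend_apply' _ _ _ fun ⟨k, hk⟩ => hX k (hk ▸ hc)]
    rfl
  have hB0 : 0 ≤ B := by simpa using hB (fun _ => False) (by simp)
  -- Relabelling the outcomes by the flips on `K` makes their probability independent of `κ`, so the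
  -- sum over `κ` can be taken first, for a fixed `o`.
  have key : bellProb d R p gX gZ 0 0 = ∑ s, v s * ∑ o, outcomeProb d R (base s) o *
      ∑ κ : K → ZMod 2, if Success gX gZ (base s + Function.extend ι κ 0)
        (o + toOutcome (Function.extend ι κ 0)) then ∏ k, bern p (κ k) else 0 := by
    unfold bellProb
    rw [hsplit]
    refine Finset.sum_congr rfl fun s _ => ?_
    congr 1
    simp only [Finset.mul_sum]
    rw [Finset.sum_comm]
    rw [Finset.sum_comm]
    conv_rhs => rw [Finset.sum_comm]
    refine Finset.sum_congr rfl fun κ _ => ?_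
    rw [← Equiv.sum_comp (Equiv.addRight (toOutcome (Function.extend ι κ 0)))]
    refine Finset.sum_congr rfl fun o _ => ?_
    rw [Equiv.coe_addRight, outcomeProb_add (hXδ κ)]
    change _ * (if Success _ _ _ _ then _ else _) = _
    split_ifs <;> ring
  rw [key]
  have h1 : ∀ s o, (∑ κ : K → ZMod 2, if Success gX gZ (base s + Function.extend ι κ 0)
      (o + toOutcome (Function.extend ι κ 0)) then ∏ k, bern p (κ k) else 0) ≤ B := by
    intro s o
    refine hB _ fun κ κ' h hκ hκ' => hopp κ κ' h _ _ hκ ?_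
    -- In characteristic two, adding `κ + κ'` to `κ` gives `κ'`; this matches the form of `hopp`.
    have e : Function.extend ι κ 0 + Function.extend ι (κ + κ') (0 : Qubit d R → ZMod 2) =
        Function.extend ι κ' 0 := by
      rw [← extend_add hι]
      congr 1
      funext k
      change κ k + (κ k + κ' k) = κ' k
      rw [← add_assoc, zmod_two_add_self, zero_add]
    rw [add_assoc, add_assoc, ← toOutcome_add, e]
    exact hκ'
  calc _ ≤ ∑ s, v s * B := by
        refine Finset.sum_le_sum fun s _ => mul_le_mul_of_nonneg_left ?_ (hv s)
        calc _ ≤ ∑ o, outcomeProb d R (base s) o * B :=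
              Finset.sum_le_sum fun o _ =>
                mul_le_mul_of_nonneg_left (h1 s o) (outcomeProb_nonneg _ _)
          _ = (∑ o, outcomeProb d R (base s) o) * B := (Finset.sum_mul ..).symm
          _ ≤ 1 * B := mul_le_mul_of_nonneg_right (sum_outcomeProb_le hd hR _) hB0
          _ = B := one_mul B
    _ = B := by rw [← Finset.sum_mul, hv1, one_mul]

/-! ### Errors on the unmeasured qubits -/

theorem q₁_mem_setB {d R : ℕ} (h : q₁ ∈ qubits d R) : q₁ ∈ setB d R := by
  exact Finset.mem_filter.2 ⟨h, by simp [q₁]⟩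

theorem q₂_mem_setB {d R : ℕ} (h : q₂ R ∈ qubits d R) : q₂ R ∈ setB d R := by
  exact Finset.mem_filter.2 ⟨h, by simp [q₂]⟩

/-- Success determines the parity of the error on `q₁, q₂`, given everything else. The best guess is
even parity, of probability `p² + (1 - p)²`. -/
theorem bellProb_le_of_endBits {d R : ℕ} (hd : 1 ≤ d) (hR : 3 ≤ R) {p : ℝ} (hp₀ : 0 ≤ p)
    (hp : p ≤ 1) (gX gZ : Finset Site → ZMod 2) :
    bellProb d R p gX gZ 0 0 ≤ 1 - 2 * (p * (1 - p)) := by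
  classical
  set ι : Fin 2 → Qubit d R :=
    ![⟨q₁, q₁_mem_qubits hd (by omega)⟩, ⟨q₂ R, q₂_mem_qubits hd (by omega)⟩] with hιdef
  have hι : Function.Injective ι := by
    have hne := q₁_ne_q₂ hR
    intro i j h
    fin_cases i <;> fin_cases j <;> simp_all [Subtype.ext_iff]
  have hq : ∀ k, (ι k).1 = q₁ ∨ (ι k).1 = q₂ R := fun k => by
    fin_cases k <;> simp [hιdef]
  have hX : ∀ k, (ι k).1 ∉ setX d R := fun k hk => by
    have := (Finset.mem_sdiff.1 (Finset.mem_filter.1 hk).1).2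
    rcases hq k with h | h <;> simp [h] at this
  refine bellProb_le hd hR hp₀ hp gX gZ hι hX
    (fun κ κ' => κ 0 + κ' 0 + (κ 1 + κ' 1) = 1) (fun J hJ => ?_) fun κ κ' h y o hs => ?_
  · have e : ∀ κ : Fin 2 → ZMod 2, κ = ![κ 0, κ 1] := fun κ => by
      ext i; fin_cases i <;> rfl
    rw [← (finTwoArrowEquiv (ZMod 2)).symm.sum_comp, Fintype.sum_prod_type]
    simp only [sum_zmod_two, Fin.prod_univ_two, finTwoArrowEquiv_symm_apply, Matrix.cons_val_zero,
      Matrix.cons_val_one, bern_zero, bern_one]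
    have h1 := hJ ![0, 0] ![0, 1] (by simp)
    have h2 := hJ ![0, 0] ![1, 0] (by simp)
    have h3 := hJ ![1, 1] ![0, 1] (by simp; decide)
    have h4 := hJ ![1, 1] ![1, 0] (by simp; decide)
    have hq : 0 ≤ p * (1 - p) := mul_nonneg hp₀ (by linarith)
    have hs : 0 ≤ (1 - 2 * p) ^ 2 := sq_nonneg _
    by_cases j0 : J ![0, 0] <;> by_cases j1 : J ![1, 1] <;> by_cases j2 : J ![0, 1] <;>
      by_cases j3 : J ![1, 0] <;> simp only [j0, j1, j2, j3, if_true, if_false] <;>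
      (first
        | exact absurd j2 (h1 j0)
        | exact absurd j3 (h2 j0)
        | exact absurd j2 (h3 j1)
        | exact absurd j3 (h4 j1)
        | nlinarith)
  · set δ : Qubit d R → ZMod 2 := Function.extend ι (κ + κ') 0 with hδ
    have hδ0 : ∀ c : Qubit d R, (∀ k, ι k ≠ c) → δ c = 0 := fun c hc => by
      rw [hδ, Function.extend_apply' _ _ _ fun ⟨k, hk⟩ => hc k hk]
      rfl
    have hout : toOutcome δ = 0 := by
      funext c
      refine hδ0 _ fun k hk => ?_
      have hc := (Finset.mem_sdiff.1 c.2).2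
      have hk' : (ι k).1 = c.1 := congrArg Subtype.val hk
      rcases hq k with h | h <;> rw [h] at hk' <;> simp [← hk'] at hc
    have hend : (endBits δ).1 + (endBits δ).2 = 1 := by
      have e1 : (endBits δ).1 = δ (ι 0) := bitAt_coe δ (ι 0)
      have e2 : (endBits δ).2 = δ (ι 1) := bitAt_coe δ (ι 1)
      rw [e1, e2, hδ, hι.extend_apply, hι.extend_apply]
      exact h
    rw [hout, add_zero]
    exact not_success_of_endBits hout (fun c hc => hδ0 c fun k hk => hX k (hk ▸ hc)) hend hs

/-! ### Homologically nontrivial cycles -/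

/-- The parity of the number of edges of the decoding graph at `u` with label `s`. -/
def incidence (d R : ℕ) (s u : Site) : ZMod 2 :=
  (((decGraph d R).edges.filter fun e => label e = s ∧ u ∈ e).card : ZMod 2)

theorem sum_ones {d R : ℕ} (o : Outcome d R) (f : Site → ZMod 2) :
    ∑ s ∈ ones o, f s = ∑ c, o c * f c.1 := by
  rw [ones, Finset.sum_image fun _ _ _ _ h => Subtype.ext h, Finset.sum_filter]
  refine Finset.sum_congr rfl fun c _ => ?_
  have : ∀ b : ZMod 2, b = 1 ∨ b = 0 := by decide
  rcases this (o c) with h | h <;> simp [h]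

theorem sum_ones_add {d R : ℕ} (o o' : Outcome d R) (f : Site → ZMod 2) :
    ∑ s ∈ ones (o + o'), f s = ∑ s ∈ ones o, f s + ∑ c, o' c * f c.1 := by
  rw [sum_ones, sum_ones, ← Finset.sum_add_distrib]
  exact Finset.sum_congr rfl fun c _ => by rw [Pi.add_apply, add_mul]

theorem setA_subset_measured (d R : ℕ) : setA d R ⊆ measured d R := fun s hs => by
  obtain ⟨h1, h2⟩ := Finset.mem_sdiff.1 hs
  refine Finset.mem_sdiff.2 ⟨h1, fun h => h2 ?_⟩
  rw [Finset.mem_insert, Finset.mem_singleton] at h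
  rcases h with rfl | rfl
  exacts [q₁_mem_setB h1, q₂_mem_setB h1]

theorem notMem_setX_of_mem_setA {d R : ℕ} {s : Site} (h : s ∈ setA d R) : s ∉ setX d R := fun hX =>
  (Finset.mem_sdiff.1 h).2 (Finset.mem_sdiff.1 (Finset.mem_filter.1 hX).1).1

theorem sum_toOutcome {d R : ℕ} {δ : Qubit d R → ZMod 2}
    (hδ : ∀ c : Qubit d R, c.1 ∉ setA d R → δ c = 0) (f : Site → ZMod 2) :
    ∑ c, toOutcome δ c * f c.1 = ∑ c, δ c * f c.1 := by
  have h1 : ∑ c, δ c * f c.1 = ∑ s ∈ qubits d R, bitAt δ s * f s := by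
    rw [← Finset.sum_coe_sort (qubits d R) fun s => bitAt δ s * f s]
    exact Finset.sum_congr rfl fun c _ => by rw [bitAt_coe]
  have h2 : ∑ c, toOutcome δ c * f c.1 = ∑ s ∈ measured d R, bitAt δ s * f s := by
    rw [← Finset.sum_coe_sort (measured d R) fun s => bitAt δ s * f s]
    exact Finset.sum_congr rfl fun c _ => by rw [toOutcome_apply]
  rw [h1, h2]
  refine Finset.sum_subset Finset.sdiff_subset fun s hs hs' => ?_
  rw [bitAt, dif_pos hs, hδ _ fun h => hs' (setA_subset_measured d R h), zero_mul]

theorem card_edgesLabelled (d R : ℕ) (S : Finset Site) (u : Site) :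
    ((((decGraph d R).edgesLabelled S).filter fun e => u ∈ e).card : ZMod 2) =
      ∑ s ∈ S, incidence d R s u := by
  rw [Finset.card_eq_sum_card_fiberwise (f := label) (t := S), Nat.cast_sum]
  · refine Finset.sum_congr rfl fun s hs => ?_
    rw [incidence]
    congr 2
    ext e
    simp only [DecodingGraph.edgesLabelled, Finset.mem_filter]
    constructor
    · rintro ⟨⟨⟨h1, _⟩, h2⟩, h3⟩
      exact ⟨h1, h3, h2⟩
    · rintro ⟨h1, h3, h2⟩
      exact ⟨⟨⟨h1, h3 ▸ hs⟩, h2⟩, h3⟩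
  · intro e he
    exact (Finset.mem_filter.1 (Finset.mem_filter.1 he).1).2

theorem incidence_eq_zero {d R : ℕ} {s : Site} (hs : s ∉ labels (decGraph d R).edges) (u : Site) :
    incidence d R s u = 0 := by
  rw [incidence, Finset.filter_false_of_mem, Finset.card_empty, Nat.cast_zero]
  rintro e he ⟨h, _⟩
  exact hs (Finset.mem_image.2 ⟨e, he, h⟩)

/-- The syndrome becomes a linear function of the outcomes over `ZMod 2`; `setA` and `setX` are
disjoint, so the symmetric difference is a union. -/
theorem mem_syndrome {d R : ℕ} (o : Outcome d R) (u : Site) :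
    u ∈ syndrome o ↔ u ∈ (decGraph d R).internal ∧
      ∑ s ∈ ones o, (if s ∈ setA d R ∨ s ∈ setX d R then incidence d R s u else 0) = 1 := by
  rw [syndrome, DecodingGraph.boundary, Finset.mem_filter, ← ZMod.natCast_eq_one_iff_odd,
    card_edgesLabelled]
  have hset : ((ones o ∩ setA d R) ∩ labels (decGraph d R).edges) ∆ (ones o ∩ setX d R) =
      (ones o).filter fun s =>
        s ∈ setA d R ∧ s ∈ labels (decGraph d R).edges ∨ s ∈ setX d R := by
    ext s
    simp only [Finset.mem_symmDiff, Finset.mem_inter, Finset.mem_filter]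
    by_cases hA : s ∈ setA d R
    · simp only [hA, notMem_setX_of_mem_setA hA, and_true, true_and, and_false, or_false,
        not_false_eq_true, false_and]
    · simp only [hA, and_false, false_and, not_false_eq_true, and_true, false_or]
  rw [hset, Finset.sum_filter]
  have : ∀ s, (if s ∈ setA d R ∧ s ∈ labels (decGraph d R).edges ∨ s ∈ setX d R then
      incidence d R s u else 0) =
      if s ∈ setA d R ∨ s ∈ setX d R then incidence d R s u else 0 := fun s => by
    by_cases h : s ∈ labels (decGraph d R).edges
    · simp [h]
    · simp [incidence_eq_zero h]
  simp only [this]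

theorem parity_eq_sum (S A T : Finset Site) :
    parity (S ∩ A) T = ∑ s ∈ S, if s ∈ A ∧ s ∈ T then 1 else 0 := by
  rw [parity, Finset.sum_boole]
  congr 2
  ext s
  simp

/-- Errors along a cycle that crosses the recovery set an odd number of times turn success into
failure. -/
theorem not_success_of_cycle {d R : ℕ} {gX gZ : Finset Site → ZMod 2} {δ : Qubit d R → ZMod 2}
    (hδ : ∀ c : Qubit d R, c.1 ∉ setA d R → δ c = 0)
    (hcycle : ∀ u ∈ (decGraph d R).internal, ∑ c, δ c * incidence d R c.1 u = 0)
    (hodd : ∑ c, δ c * (if c.1 ∈ recoveryX d R then 1 else 0) = 1)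
    {y : Qubit d R → ZMod 2} {o : Outcome d R} (h : Success gX gZ y o) :
    ¬ Success gX gZ (y + δ) (o + toOutcome δ) := by
  have hX : ∀ c : Qubit d R, c.1 ∈ setX d R → δ c = 0 := fun c hc =>
    hδ c fun hA => notMem_setX_of_mem_setA hA hc
  have hcongr : ∀ f f' : Site → ZMod 2, (∀ s ∈ setA d R, f s = f' s) →
      ∑ c, δ c * f c.1 = ∑ c, δ c * f' c.1 := fun f f' hf =>
    Finset.sum_congr rfl fun c _ => by
      by_cases hc : c.1 ∈ setA d R
      · rw [hf _ hc]
      · rw [hδ c hc, zero_mul, zero_mul]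
  refine not_success_of_correctionX ?_ ?_ h
  -- Both unmeasured qubits lie in `setB`, where `δ` vanishes, so the state itself is not shifted.
  · have hend : endBits δ = 0 := by
      have : ∀ s, s ∈ setB d R → bitAt δ s = 0 := fun s hs => by
        unfold bitAt
        split_ifs with hq
        · exact hδ _ fun hA => (Finset.mem_sdiff.1 hA).2 hs
        · rfl
      refine Prod.ext ?_ ?_
      · by_cases hq : q₁ ∈ qubits d R
        · exact this _ (q₁_mem_setB hq)
        · exact dif_neg hq
      · by_cases hq : q₂ R ∈ qubits d R
        · exact this _ (q₂_mem_setB hq)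
        · exact dif_neg hq
    funext t
    have := postMeasurement_add hX y o t
    rwa [hend, add_zero] at this
  -- By linearity the syndrome changes by the boundary of the cycle, which is zero. Hence `gX`
  -- returns the same bit, and `ĉ_X` changes only through the recovery set.
  · have hsyn : syndrome (o + toOutcome δ) = syndrome o := by
      ext u
      rw [mem_syndrome, mem_syndrome]
      refine and_congr_right fun hu => ?_
      rw [sum_ones_add, sum_toOutcome hδ
        fun s => if s ∈ setA d R ∨ s ∈ setX d R then incidence d R s u else 0,
        hcongr (fun s => if s ∈ setA d R ∨ s ∈ setX d R then incidence d R s u else 0)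
          (fun s => incidence d R s u), hcycle u hu, add_zero]
      intro s hs
      simp [hs]
    rw [correctionX, correctionX, hsyn]
    simp only [parity_eq_sum, sum_ones_add]
    rw [sum_toOutcome hδ fun s => if s ∈ setA d R ∧ s ∈ recoveryX d R ∩ setA d R then 1 else 0,
      sum_toOutcome hδ fun s => if s ∈ setX d R ∧ s ∈ recoveryX d R ∩ setB d R then 1 else 0,
      hcongr (fun s => if s ∈ setA d R ∧ s ∈ recoveryX d R ∩ setA d R then 1 else 0)
        fun s => if s ∈ recoveryX d R then 1 else 0, hodd,
      hcongr (fun s => if s ∈ setX d R ∧ s ∈ recoveryX d R ∩ setB d R then 1 else 0) fun _ => 0]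
    · simp only [mul_zero, Finset.sum_const_zero]
      ring
    · intro s hs
      simp [notMem_setX_of_mem_setA hs]
    · intro s hs
      simp [hs]

/-! ### Edges of the decoding graph in the bulk -/

theorem incidence_eq {d R : ℕ} {s v w : Site} (hvw : v ≠ w) (hmem : s(v, w) ∈ (decGraph d R).edges)
    (hlabel : label s(v, w) = s) (huniq : ∀ e ∈ (decGraph d R).edges, label e = s → e = s(v, w))
    (u : Site) :
    incidence d R s u = (if u = v then 1 else 0) + if u = w then 1 else 0 := by
  have h : (decGraph d R).edges.filter (fun e => label e = s ∧ u ∈ e) =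
      if u = v ∨ u = w then {s(v, w)} else ∅ := by
    ext e
    split_ifs with hu
    · rw [Finset.mem_filter, Finset.mem_singleton]
      constructor
      · exact fun h => huniq e h.1 h.2.1
      · rintro rfl
        exact ⟨hmem, hlabel, Sym2.mem_iff.2 hu⟩
    · rw [Finset.mem_filter]
      refine ⟨?_, fun h => absurd h (Finset.notMem_empty _)⟩
      rintro ⟨h1, h2, h3⟩
      rw [huniq e h1 h2, Sym2.mem_iff] at h3
      exact absurd h3 hu
  rw [incidence, h]
  by_cases h1 : u = v
  · have h2 : u ≠ w := h1 ▸ hvw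
    simp [h1, hvw]
  · by_cases h2 : u = w <;> simp [h1, h2]
    exact fun h => (hvw h.symm).elim

/-- Edges of length one and edges of the two outer layers have labels with odd `u₃`, because `R` is
odd. At even height only edges of length two remain, and the label determines the edge. -/
theorem exists_of_mem_decGraph_edges {d R : ℕ} (hR : Odd R) {e : Sym2 Site}
    (he : e ∈ (decGraph d R).edges) (hk : Even (label e).2.2) :
    ∃ x₁ x₂ x₃ y₁ y₂ y₃ : ℤ, e = s((x₁, x₂, x₃), (y₁, y₂, y₃)) ∧
      Even x₁ ∧ Even x₂ ∧ Even y₁ ∧ Even y₂ ∧ Even (x₃ + y₃) ∧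
      |x₁ - y₁| + |x₂ - y₂| + |x₃ - y₃| = 2 := by
  have hR' : (R : ℤ) % 2 = 1 := by
    obtain ⟨m, rfl⟩ := hR
    push_cast
    omega
  rcases Finset.mem_union.1 he with h | h
  · obtain ⟨⟨⟨x₁, x₂, x₃⟩, ⟨y₁, y₂, y₃⟩⟩, h1, rfl⟩ := Finset.mem_image.1 h
    obtain ⟨hxy, h1⟩ := Finset.mem_filter.1 h1
    obtain ⟨hx, hy⟩ := Finset.mem_product.1 hxy
    have hev : ∀ z : Site, z ∈ evenBulk d R ∪ evenBoundary d R → Even z.1 ∧ Even z.2.1 := by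
      intro z hz
      rcases Finset.mem_union.1 hz with h | h <;>
        exact (Finset.mem_filter.1 (Finset.mem_filter.1 h).1).2
    have hx' := hev _ hx
    have hy' := hev _ hy
    dsimp only at hx' hy' h1
    refine ⟨x₁, x₂, x₃, y₁, y₂, y₃, rfl, hx'.1, hx'.2, hy'.1, hy'.2, ?_⟩
    simp only [dist] at h1
    simp only [Int.even_iff] at hx' hy' ⊢
    change Even (if Even (x₃ + y₃) then (x₃ + y₃) / 2 else if Odd x₃ then x₃ else y₃) at hk
    have hsum : Even (x₃ + y₃) := by
      by_contra hne
      rw [if_neg hne] at hk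
      split_ifs at hk with ho
      · exact Int.not_even_iff_odd.2 ho hk
      · rw [Int.not_odd_iff_even] at ho
        exact hne (ho.add hk)
    refine ⟨Int.even_iff.1 hsum, ?_⟩
    rw [Int.even_iff] at hsum
    rcases h1 with h1 | h1
    · exact h1.1
    · rcases abs_cases (x₁ - y₁) with h | h <;> rcases abs_cases (x₂ - y₂) with h' | h' <;>
        rcases abs_cases (x₃ - y₃) with h'' | h'' <;> omega
  · obtain ⟨⟨⟨x₁, x₂, x₃⟩, ⟨y₁, y₂, y₃⟩⟩, h1, rfl⟩ := Finset.mem_image.1 h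
    obtain ⟨hxy, h1⟩ := Finset.mem_filter.1 h1
    obtain ⟨hx, -⟩ := Finset.mem_product.1 hxy
    have hx3 := (Finset.mem_filter.1 hx).2.1
    have heq := h1.1
    dsimp only at heq hx3
    subst heq
    change Even (if Even (x₃ + x₃) then (x₃ + x₃) / 2 else if Odd x₃ then x₃ else x₃) at hk
    rw [if_pos ⟨x₃, rfl⟩, Int.even_iff] at hk
    omega

theorem label_mk (x₁ x₂ x₃ y₁ y₂ y₃ : ℤ) (h : Even (x₃ + y₃)) :
    label s((x₁, x₂, x₃), (y₁, y₂, y₃)) = ((x₁ + y₁) / 2, (x₂ + y₂) / 2, (x₃ + y₃) / 2) := by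
  change (_, _, if Even (x₃ + y₃) then _ else _) = _
  rw [if_pos h]

theorem mem_bulk_or_boundary {d R : ℕ} {a b k : ℤ} (ha : Even a) (hb : Even b) (hk : Even k)
    (ha₀ : 0 ≤ a) (ha₁ : a ≤ 2 * d) (hb₀ : 0 ≤ b) (hb₁ : b ≤ 2 * d - 2) (hk₀ : 1 ≤ k)
    (hk₁ : k ≤ R) : (a, b, k) ∈ evenBulk d R ∪ evenBoundary d R := by
  rw [Int.even_iff] at ha
  by_cases h : 2 ≤ a ∧ a ≤ 2 * d - 2
  · refine Finset.mem_union_left _ ?_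
    simp only [evenBulk, evenEvenSites, Finset.mem_filter, Finset.mem_product, Finset.mem_Icc]
    exact ⟨⟨⟨⟨ha₀, ha₁⟩, ⟨hb₀, hb₁⟩, hk₀, hk₁⟩, Int.even_iff.2 ha, hb⟩, hk, h⟩
  · refine Finset.mem_union_right _ ?_
    simp only [evenBoundary, evenEvenSites, Finset.mem_filter, Finset.mem_product, Finset.mem_Icc]
    exact ⟨⟨⟨⟨ha₀, ha₁⟩, ⟨hb₀, hb₁⟩, hk₀, hk₁⟩, Int.even_iff.2 ha, hb⟩, .inr ⟨hk, by omega⟩⟩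

theorem notMem_evenBoundary {d R : ℕ} {a b k : ℤ} (hR : Odd R) (hk : Even k) (ha₀ : a ≠ 0)
    (ha₁ : a ≠ 2 * d) : (a, b, k) ∉ evenBoundary d R := by
  have hR' : (R : ℤ) % 2 = 1 := by
    obtain ⟨m, rfl⟩ := hR
    push_cast
    omega
  rw [Int.even_iff] at hk
  simp only [evenBoundary, Finset.mem_filter, not_and]
  intro _
  omega

theorem mk_mem_edges {d R : ℕ} {v w : Site} (hv : v ∈ evenBulk d R ∪ evenBoundary d R)
    (hw : w ∈ evenBulk d R ∪ evenBoundary d R) (h : dist v w = 2)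
    (hn : v ∉ evenBoundary d R ∨ w ∉ evenBoundary d R) : s(v, w) ∈ (decGraph d R).edges := by
  refine Finset.mem_union_left _ (Finset.mem_image.2 ⟨(v, w), ?_, rfl⟩)
  refine Finset.mem_filter.2 ⟨Finset.mem_product.2 ⟨hv, hw⟩, .inl ⟨h, ?_⟩⟩
  tauto

theorem incidence_horizontal {d R : ℕ} (hd : 2 ≤ d) (hR : Odd R) {a b k : ℤ} (ha : Odd a)
    (hb : Even b) (hk : Even k) (ha₀ : 0 ≤ a) (ha₁ : a ≤ 2 * d) (hb₀ : 0 ≤ b)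
    (hb₁ : b ≤ 2 * d - 2) (hk₀ : 1 ≤ k) (hk₁ : k ≤ R) (u : Site) :
    incidence d R (a, b, k) u =
      (if u = (a - 1, b, k) then 1 else 0) + if u = (a + 1, b, k) then 1 else 0 := by
  have ha' := Int.odd_iff.1 ha
  have hkk : Even (k + k) := ⟨k, rfl⟩
  refine incidence_eq (fun h => ?_) (mk_mem_edges
    (mem_bulk_or_boundary (Int.even_iff.2 (by omega)) hb hk (by omega) (by omega) hb₀ hb₁ hk₀ hk₁)
    (mem_bulk_or_boundary (Int.even_iff.2 (by omega)) hb hk (by omega) (by omega) hb₀ hb₁ hk₀ hk₁)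
    ?_ ?_) ?_ (fun e he hl => ?_) u
  · have := congrArg Prod.fst h
    dsimp only at this
    omega
  · simp [dist, show a - 1 - (a + 1) = -2 by ring]
  -- At most one endpoint lies on a side: for `a = 1` the left one does, and `d ≥ 2` keeps the right
  -- one inside.
  · by_cases h : a = 1
    · exact .inr (notMem_evenBoundary hR hk (by omega) (by omega))
    · exact .inl (notMem_evenBoundary hR hk (by omega) (by omega))
  · rw [label_mk _ _ _ _ _ _ hkk]
    refine Prod.ext ?_ (Prod.ext ?_ ?_) <;> dsimp only <;> omega
  · obtain ⟨x₁, x₂, x₃, y₁, y₂, y₃, rfl, h1, h2, h3, h4, h5, h6⟩ :=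
      exists_of_mem_decGraph_edges hR he (by rw [hl]; exact hk)
    rw [label_mk _ _ _ _ _ _ h5] at hl
    simp only [Prod.mk.injEq] at hl
    simp only [Sym2.eq_iff, Prod.mk.injEq]
    rw [Int.even_iff] at h1 h2 h3 h4 h5 hb hk
    rcases abs_cases (x₁ - y₁) with h | h <;> rcases abs_cases (x₂ - y₂) with h' | h' <;>
      rcases abs_cases (x₃ - y₃) with h'' | h'' <;> omega

theorem incidence_vertical {d R : ℕ} (hR : Odd R) {a b k : ℤ} (ha : Even a)
    (hb : Odd b) (hk : Even k) (ha₀ : 1 ≤ a) (ha₁ : a ≤ 2 * d - 1) (hb₀ : 0 ≤ b)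
    (hb₁ : b ≤ 2 * d - 2) (hk₀ : 1 ≤ k) (hk₁ : k ≤ R) (u : Site) :
    incidence d R (a, b, k) u =
      (if u = (a, b - 1, k) then 1 else 0) + if u = (a, b + 1, k) then 1 else 0 := by
  have hb' := Int.odd_iff.1 hb
  have hkk : Even (k + k) := ⟨k, rfl⟩
  refine incidence_eq (fun h => ?_) (mk_mem_edges
    (mem_bulk_or_boundary ha (Int.even_iff.2 (by omega)) hk (by omega) (by omega) (by omega)
      (by omega) hk₀ hk₁)
    (mem_bulk_or_boundary ha (Int.even_iff.2 (by omega)) hk (by omega) (by omega) (by omega)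
      (by omega) hk₀ hk₁)
    ?_ ?_) ?_ (fun e he hl => ?_) u
  · have := congrArg (fun s : Site => s.2.1) h
    dsimp only at this
    omega
  · simp [dist, show b - 1 - (b + 1) = -2 by ring]
  · exact .inl (notMem_evenBoundary hR hk (by omega) (by omega))
  · rw [label_mk _ _ _ _ _ _ hkk]
    refine Prod.ext ?_ (Prod.ext ?_ ?_) <;> dsimp only <;> omega
  · obtain ⟨x₁, x₂, x₃, y₁, y₂, y₃, rfl, h1, h2, h3, h4, h5, h6⟩ :=
      exists_of_mem_decGraph_edges hR he (by rw [hl]; exact hk)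
    rw [label_mk _ _ _ _ _ _ h5] at hl
    simp only [Prod.mk.injEq] at hl
    simp only [Sym2.eq_iff, Prod.mk.injEq]
    rw [Int.even_iff] at h1 h2 h3 h4 h5 ha hk
    rcases abs_cases (x₁ - y₁) with h | h <;> rcases abs_cases (x₂ - y₂) with h' | h' <;>
      rcases abs_cases (x₃ - y₃) with h'' | h'' <;> omega

theorem mem_setA {d R : ℕ} (hR : Odd R) {a b k : ℤ} (hab : Odd a ∧ Even b ∨ Even a ∧ Odd b)
    (hk : Even k) (ha₀ : 1 ≤ a) (ha₁ : a ≤ 2 * d - 1) (hb₀ : 0 ≤ b)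
    (hb₁ : b ≤ 2 * d - 2) (hk₀ : 1 ≤ k) (hk₁ : k ≤ R) : (a, b, k) ∈ setA d R := by
  have hR' : (R : ℤ) % 2 = 1 := by
    obtain ⟨m, rfl⟩ := hR
    push_cast
    omega
  simp only [setA, setB, qubits, Finset.mem_sdiff, Finset.mem_filter, Finset.mem_product,
    Finset.mem_Icc]
  simp only [Int.even_iff, Int.odd_iff] at *
  omega

/-- Vertices on the two sides carry no syndrome, so a path ending there counts as a cycle. -/
theorem ne_of_mem_internal {d R : ℕ} (hR : Odd R) {b k : ℤ} (_ : b ≤ 2 * d - 2) (hk : Even k)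
    {u : Site} (hu : u ∈ (decGraph d R).internal) : u ≠ (0, b, k) ∧ u ≠ (2 * (d : ℤ), b, k) := by
  have hR' : (R : ℤ) % 2 = 1 := by
    obtain ⟨m, rfl⟩ := hR
    push_cast
    omega
  rw [Int.even_iff] at hk
  rcases Finset.mem_union.1 hu with h | h
  · have h1 := (Finset.mem_filter.1 h).2
    exact ⟨fun e => h1.1 (by rw [e]), fun e => h1.2.1 (by rw [e])⟩
  · obtain ⟨h1, h2, -⟩ := Finset.mem_filter.1 h
    have h3 := (Finset.mem_filter.1 h1).2.1
    refine ⟨fun e => h2 (by rw [e]), fun e => ?_⟩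
    rw [e] at h3
    dsimp only at h3
    omega

/-! ### Parallel tubes -/

theorem sum_extend {K Q : Type} [Fintype K] [Fintype Q] {ι : K → Q} (hι : Function.Injective ι)
    (κ : K → ZMod 2) (F : Q → ZMod 2) :
    ∑ c, Function.extend ι κ 0 c * F c = ∑ k, κ k * F (ι k) := by
  symm
  refine Fintype.sum_of_injective ι hι _ _ (fun c hc => ?_) fun k => ?_
  · rw [Function.extend_apply' _ _ _ fun ⟨k, hk⟩ => hc ⟨k, hk⟩, Pi.zero_apply, zero_mul]
  · rw [hι.extend_apply]

open scoped Classical in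
/-- A bound for parallel copies of a set of qubits in the planes of even `u₃`. -/
theorem bellProb_le_of_planes {d R N : ℕ} (hd : 1 ≤ d) (hR : 3 ≤ R) (hN : 2 * N + 1 ≤ R) {p : ℝ}
    (hp₀ : 0 ≤ p) (hp : p ≤ 1) (gX gZ : Finset Site → ZMod 2) {E : Type} [Fintype E]
    [DecidableEq E] (pt : E → ℤ × ℤ) (hpt : Function.Injective pt)
    (opp : (E → ZMod 2) → (E → ZMod 2) → Prop) {B : ℝ}
    (hA : ∀ e k, Even k → 1 ≤ k → k ≤ (R : ℤ) → ((pt e).1, (pt e).2, k) ∈ setA d R)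
    (hcycle : ∀ t t', opp t t' → ∀ k, Even k → 1 ≤ k → k ≤ (R : ℤ) →
      ∀ u ∈ (decGraph d R).internal,
        ∑ e, (t e + t' e) * incidence d R ((pt e).1, (pt e).2, k) u = 0)
    (hodd : ∀ t t', opp t t' → ∀ k, Even k → 1 ≤ k → k ≤ (R : ℤ) →
      ∑ e, (t e + t' e) * (if ((pt e).1, (pt e).2, k) ∈ recoveryX d R then 1 else 0) = 1)
    (hB : ∀ J : (Fin N → E → ZMod 2) → Prop,
      (∀ f j t, opp (f j) t → J f → ¬ J (Function.update f j t)) →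
        ∑ f, (if J f then ∏ j, ∏ e, bern p (f j e) else 0) ≤ B) :
    bellProb d R p gX gZ 0 0 ≤ B := by
  have hk : ∀ j : Fin N, Even (2 * (j : ℤ) + 2) ∧ 1 ≤ 2 * (j : ℤ) + 2 ∧ 2 * (j : ℤ) + 2 ≤ R :=
    fun j => ⟨⟨j + 1, by ring⟩, by omega, by omega⟩
  have hA' : ∀ (j : Fin N) e, ((pt e).1, (pt e).2, 2 * (j : ℤ) + 2) ∈ setA d R := fun j e =>
    hA e _ (hk j).1 (hk j).2.1 (hk j).2.2
  let ι : Fin N × E → Qubit d R := fun a =>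
    ⟨((pt a.2).1, (pt a.2).2, 2 * (a.1 : ℤ) + 2), (Finset.mem_sdiff.1 (hA' a.1 a.2)).1⟩
  have hι : Function.Injective ι := by
    rintro ⟨j, e⟩ ⟨j', e'⟩ h
    have h := congrArg Subtype.val h
    simp only [ι, Prod.mk.injEq] at h
    have h3 : 2 * (j : ℤ) + 2 = 2 * (j' : ℤ) + 2 := h.2.2
    exact Prod.ext (Fin.ext (by change (j : ℕ) = j'; omega)) (hpt (Prod.ext h.1 h.2.1))
  refine bellProb_le hd hR hp₀ hp gX gZ hι (fun a => notMem_setX_of_mem_setA (hA' a.1 a.2))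
    -- Opposite patterns differ in a single plane, so their difference is one crossing path;
    -- crossings in two planes would cancel in `ĉ_X`.
    (fun κ κ' => ∃ j, opp (fun e => κ (j, e)) (fun e => κ' (j, e)) ∧
      ∀ j' ≠ j, ∀ e, κ' (j', e) = κ (j', e)) (fun J hJ => ?_) ?_
  · have := hB (fun f => J fun a => f a.1 a.2) fun f j t h hf => ?_
    · rw [← (Equiv.curry (Fin N) E (ZMod 2)).symm.sum_comp]
      refine le_trans (le_of_eq ?_) this
      refine Finset.sum_congr rfl fun f _ => ?_
      have e1 : (Equiv.curry (Fin N) E (ZMod 2)).symm f = fun a => f a.1 a.2 := rfl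
      rw [e1, Fintype.prod_prod_type]
    · refine hJ _ _ ⟨j, ?_, fun j' hj' e => ?_⟩ hf
      · simpa using h
      · simp [hj']
  · rintro κ κ' ⟨j, hj, hj'⟩ y o hs
    have hsum : ∀ F : Site → ZMod 2,
        ∑ c : Qubit d R, Function.extend ι (κ + κ') 0 c * F c.1 =
          ∑ e, (κ (j, e) + κ' (j, e)) * F ((pt e).1, (pt e).2, 2 * (j : ℤ) + 2) := fun F => by
      rw [sum_extend hι (κ + κ') fun c => F c.1, Fintype.sum_prod_type, Finset.sum_eq_single j]
      · rfl
      · intro j' _ hne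
        refine Finset.sum_eq_zero fun e _ => ?_
        rw [Pi.add_apply, hj' j' hne, zmod_two_add_self, zero_mul]
      · simp
    refine not_success_of_cycle (fun c hc => ?_) (fun u hu => ?_) ?_ hs
    · rw [Function.extend_apply' _ _ _ fun ⟨a, ha⟩ => hc (ha ▸ hA' a.1 a.2)]
      rfl
    · exact (hsum fun s => incidence d R s u).trans
        (hcycle _ _ hj _ (hk j).1 (hk j).2.1 (hk j).2.2 u hu)
    · exact (hsum fun s => if s ∈ recoveryX d R then 1 else 0).trans
        (hodd _ _ hj _ (hk j).1 (hk j).2.1 (hk j).2.2)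

theorem sum_telescope (D : ℕ → ZMod 2) (n : ℕ) :
    ∑ i : Fin n, (D i + D (i + 1)) = D 0 + D n := by
  rw [Fin.sum_univ_eq_sum_range (fun i => D i + D (i + 1))]
  induction n with
  | zero => rw [Finset.sum_range_zero, zmod_two_add_self]
  | succ n ih =>
    rw [Finset.sum_range_succ, ih]
    linear_combination zmod_two_add_self (D n)

/-! ### Straight lines -/

theorem mem_recoveryX {d R : ℕ} {a b k : ℤ} (h : (a, b, k) ∈ setA d R) (hb : Even b) (hk : Even k)
    (ha : a = 1) : (a, b, k) ∈ recoveryX d R :=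
  Finset.mem_filter.2 ⟨(Finset.mem_sdiff.1 h).1, ha, hb, .inr hk⟩

theorem notMem_recoveryX {d R : ℕ} {a b k : ℤ} (ha : a ≠ 1) : (a, b, k) ∉ recoveryX d R := fun h =>
  ha (Finset.mem_filter.1 h).2.1

/-- The cycle is the whole row `u₂ = 0`: its boundary telescopes to the two sides, and it meets the
recovery set only at `u₁ = 1`. -/
theorem bellProb_le_of_lines {d R N : ℕ} (hd : 2 ≤ d) (hR : 3 ≤ R) (hRo : Odd R)
    (hN : 2 * N + 1 ≤ R) {p : ℝ} (hp₀ : 0 < p) (hp : p ≤ 1 / 2) (gX gZ : Finset Site → ZMod 2) :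
    bellProb d R p gX gZ 0 0 ≤ 1 / 2 + (1 - (2 * p) ^ d) ^ N / 2 := by
  have hA : ∀ (i : Fin d) (k : ℤ), Even k → 1 ≤ k → k ≤ (R : ℤ) →
      (2 * (i : ℤ) + 1, (0 : ℤ), k) ∈ setA d R := fun i k hk h1 h2 =>
    mem_setA hRo (.inl ⟨⟨i, rfl⟩, Even.zero⟩) hk (by omega) (by omega) le_rfl (by omega) h1 h2
  have hone : ∀ t t' : Fin d → ZMod 2, t' = t + 1 → ∀ i, t i + t' i = 1 := fun t t' h i => by
    have : ∀ b : ZMod 2, b + (b + 1) = 1 := by decide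
    rw [h]
    exact this (t i)
  refine bellProb_le_of_planes (by omega) hR hN hp₀.le (by linarith) gX gZ
    (fun i : Fin d => (2 * (i : ℤ) + 1, (0 : ℤ))) (fun i j h => ?_) (fun t t' => t' = t + 1) hA
    (fun t t' h k hk h1 h2 u hu => ?_) (fun t t' h k hk h1 h2 => ?_) fun J hJ => ?_
  · have := congrArg Prod.fst h
    dsimp only at this
    exact Fin.ext (by omega)
  · have hinc : ∀ i : Fin d, (t i + t' i) * incidence d R (2 * (i : ℤ) + 1, 0, k) u =
        (if u = (2 * ((i : ℕ) : ℤ), 0, k) then 1 else 0) +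
          if u = (2 * (((i : ℕ) + 1 : ℕ) : ℤ), 0, k) then 1 else 0 := fun i => by
      rw [hone t t' h, one_mul, incidence_horizontal hd hRo ⟨i, rfl⟩ Even.zero hk (by omega)
        (by omega) le_rfl (by omega) h1 h2, add_sub_cancel_right]
      push_cast
      rw [mul_add, mul_one, add_assoc]
      norm_num
    simp only [hinc]
    rw [sum_telescope fun i => if u = (2 * (i : ℤ), 0, k) then 1 else 0]
    have hne := ne_of_mem_internal (b := 0) hRo (by omega) hk hu
    rw [Nat.cast_zero, mul_zero, if_neg hne.1, if_neg hne.2, add_zero]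
  · rw [Finset.sum_eq_single ⟨0, by omega⟩]
    · rw [hone t t' h, one_mul, if_pos (mem_recoveryX (hA _ k hk h1 h2) Even.zero hk (by simp))]
    · intro i _ hi
      rw [if_neg (notMem_recoveryX _), mul_zero]
      intro h
      exact hi (Fin.ext (by simp; omega))
    · simp
  · refine sum_lines_le hp₀ hp d N J fun f j => hJ f j _ rfl

/-! ### Tubes with detours -/

/-- The positions of the edges of a tube within a plane of even `u₃`: the end edges at `u₁ = 1` and
`u₁ = 2 n + 3` and the blocks in between run along `u₂ = 2`, and the detours of the blocks run
alternately along `u₂ = 4` and `u₂ = 0`. -/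
def tubePoint (n : ℕ) : TubeEdge n → ℤ × ℤ
  | .inl a => ((2 * n + 2) * (a : ℤ) + 1, 2)
  | .inr (i, j) =>
    (2 * (i : ℤ) + ![3, 2, 3, 4] j,
      ![2, 3 - 2 * ((i : ℤ) % 2), 4 - 4 * ((i : ℤ) % 2), 3 - 2 * ((i : ℤ) % 2)] j)

/-- Consecutive blocks both have a vertical edge at their common value of `u₁`; alternating the side
of the detour keeps these apart. -/
theorem tubePoint_injective (n : ℕ) : Function.Injective (tubePoint n) := by
  rintro (a | ⟨i, j⟩) (a' | ⟨i', j'⟩) h <;> have h1 := congrArg Prod.fst h <;>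
    have h2 := congrArg Prod.snd h <;> simp only [tubePoint] at h1 h2
  · fin_cases a <;> fin_cases a' <;> simp at h1 ⊢ <;> omega
  · fin_cases a <;> fin_cases j' <;> simp at h1 h2 <;> omega
  · fin_cases a' <;> fin_cases j <;> simp at h1 h2 <;> omega
  · have hi : i = i' ∧ j = j' := by
      fin_cases j <;> fin_cases j' <;> simp at h1 h2 ⊢ <;> omega
    rw [hi.1, hi.2]

/-- Equal syndromes force the detour to be flipped as a whole or not at all. Its majority then
changes by that same bit, so the reversed class determines the change of the direct edge: exactly
one of the two routes is flipped. -/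
theorem block_add (x x' : Fin 4 → ZMod 2) (hs : blockSyn x' = blockSyn x)
    (hc : blockClass x' = blockClass x + 1) :
    x 0 + x' 0 = 1 + (x 1 + x' 1) ∧ x 2 + x' 2 = x 1 + x' 1 ∧ x 3 + x' 3 = x 1 + x' 1 := by
  have key₁ : ∀ b c b' c' : ZMod 2, b' + c' = b + c → c + c' = b + b' := by decide
  have key₂ : ∀ b b' c c' : ZMod 2, c + c' = b + b' → c' = c + (b + b') := by decide
  have key₃ : ∀ a a' b c d h : ZMod 2,
      a' + ((b + h) * (c + h) + (c + h) * (d + h) + (b + h) * (d + h)) =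
        a + (b * c + c * d + b * d) + 1 → a + a' = 1 + h := by decide
  simp only [blockSyn, Prod.mk.injEq] at hs
  have h2 := key₁ _ _ _ _ hs.1
  have h3 := (key₁ _ _ _ _ hs.2).trans h2
  refine ⟨key₃ _ _ (x 1) (x 2) (x 3) _ ?_, h2, h3⟩
  rw [← key₂ _ _ _ _ h2, ← key₂ _ _ _ _ h3, ← key₂ _ _ _ _ rfl]
  exact hc

/-- By `hF` a detour has the same value of `F` as its direct edge, so any difference of opposite
errors can be replaced by the straight row. -/
theorem sum_tubeOpp {n : ℕ} {t t' : TubeEdge n → ZMod 2} (h : TubeOpp t t')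
    (F : TubeEdge n → ZMod 2)
    (hF : ∀ i, F (.inr (i, 1)) + F (.inr (i, 2)) + F (.inr (i, 3)) = F (.inr (i, 0))) :
    ∑ e, (t e + t' e) * F e = F (.inl 0) + F (.inl 1) + ∑ i, F (.inr (i, 0)) := by
  rw [Fintype.sum_sum_type, Fin.sum_univ_two, Fintype.sum_prod_type]
  have h1 : ∀ a, t (.inl a) + t' (.inl a) = 1 := fun a => by
    have : ∀ b : ZMod 2, b + (b + 1) = 1 := by decide
    rw [h.1, this]
  rw [h1, h1, one_mul, one_mul]
  congr 1
  refine Finset.sum_congr rfl fun i _ => ?_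
  obtain ⟨h2, h3, h4⟩ := block_add (fun j => t (.inr (i, j))) (fun j => t' (.inr (i, j)))
    (congrArg Prod.fst (h.2 i)) (congrArg Prod.snd (h.2 i))
  rw [Fin.sum_univ_four, h2, h3, h4, ← hF i]
  linear_combination (F (.inr (i, 1)) + F (.inr (i, 2)) + F (.inr (i, 3))) *
    zmod_two_add_self (t (.inr (i, 1)) + t' (.inr (i, 1)))

theorem bellProb_le_of_tubes {n R N : ℕ} (hn₀ : 2 ≤ n) (hn : Even n) (hR : 3 ≤ R) (hRo : Odd R)
    (hN : 2 * N + 1 ≤ R) {p : ℝ} (hp₀ : 0 < p) (hp : p ≤ 1 / 2) (gX gZ : Finset Site → ZMod 2)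
    (hβ : 1 ≤ N * (2 * p ^ 2 * blockRate p ^ n / (n + 1) ^ 2)) :
    bellProb (n + 2) R p gX gZ 0 0 ≤ 3 / 4 := by
  have hA : ∀ (e : TubeEdge n) (k : ℤ), Even k → 1 ≤ k → k ≤ (R : ℤ) →
      ((tubePoint n e).1, (tubePoint n e).2, k) ∈ setA (n + 2) R := by
    intro e k hk h1 h2
    rcases e with a | ⟨i, j⟩
    · fin_cases a <;> simp only [tubePoint] <;>
        refine mem_setA hRo ?_ hk ?_ ?_ ?_ ?_ h1 h2 <;> simp [Int.odd_iff, Int.even_iff] <;> omega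
    · fin_cases j <;> simp only [tubePoint] <;>
        refine mem_setA hRo ?_ hk ?_ ?_ ?_ ?_ h1 h2 <;> simp [Int.odd_iff, Int.even_iff] <;> omega
  refine bellProb_le_of_planes (by omega) hR hN hp₀.le (by linarith) gX gZ (tubePoint n)
    (tubePoint_injective n) TubeOpp hA (fun t t' h k hk h1 h2 u hu => ?_)
    (fun t t' h k hk h1 h2 => ?_) fun J hJ => sum_tubes_le hp₀ hp hn N J hJ hβ
  · set P : ℤ → ℤ → ZMod 2 := fun a b => if u = (a, b, k) then 1 else 0 with hP
    have hor : ∀ a b a₁ a₂ : ℤ, a₁ = a - 1 → a₂ = a + 1 → a % 2 = 1 → b % 2 = 0 → 0 ≤ a →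
        a ≤ 2 * n + 4 → 0 ≤ b → b ≤ 4 → incidence (n + 2) R (a, b, k) u = P a₁ b + P a₂ b := by
      rintro a b _ _ rfl rfl ha hb a0 a1 b0 b1
      exact incidence_horizontal (by omega) hRo (Int.odd_iff.2 ha) (Int.even_iff.2 hb) hk a0
        (by push_cast; omega) b0 (by push_cast; omega) h1 h2 u
    have ver : ∀ a b b₁ b₂ : ℤ, b₁ = b - 1 → b₂ = b + 1 → a % 2 = 0 → b % 2 = 1 → 1 ≤ a →
        a ≤ 2 * n + 3 → 0 ≤ b → b ≤ 4 → incidence (n + 2) R (a, b, k) u = P a b₁ + P a b₂ := by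
      rintro a b _ _ rfl rfl ha hb a0 a1 b0 b1
      exact incidence_vertical hRo (Int.even_iff.2 ha) (Int.odd_iff.2 hb) hk a0
        (by push_cast; omega) b0 (by push_cast; omega) h1 h2 u
    have f0 : ∀ i : Fin n, incidence (n + 2) R (2 * (i : ℤ) + 3, 2, k) u =
        P (2 * ((i : ℕ) : ℤ) + 2) 2 + P (2 * (((i : ℕ) + 1 : ℕ) : ℤ) + 2) 2 := fun i =>
      hor _ _ _ _ (by ring) (by push_cast; ring) (by omega) (by omega) (by omega) (by omega)
        (by omega) (by omega)
    -- A detour and its direct edge have the same boundary; the two corner vertices cancel.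
    have f13 : ∀ i : Fin n,
        incidence (n + 2) R (2 * (i : ℤ) + 2, 3 - 2 * ((i : ℤ) % 2), k) u +
        incidence (n + 2) R (2 * (i : ℤ) + 3, 4 - 4 * ((i : ℤ) % 2), k) u +
        incidence (n + 2) R (2 * (i : ℤ) + 4, 3 - 2 * ((i : ℤ) % 2), k) u =
        incidence (n + 2) R (2 * (i : ℤ) + 3, 2, k) u := fun i => by
      have e0 := hor (2 * (i : ℤ) + 3) 2 (2 * i + 2) (2 * i + 4) (by ring) (by ring) (by omega)
        (by omega) (by omega) (by omega) (by omega) (by omega)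
      have e2 := hor (2 * (i : ℤ) + 3) (4 - 4 * ((i : ℤ) % 2)) (2 * i + 2) (2 * i + 4) (by ring)
        (by ring) (by omega) (by omega) (by omega) (by omega) (by omega) (by omega)
      have e1 := ver (2 * (i : ℤ) + 2) (3 - 2 * ((i : ℤ) % 2)) _ _ rfl rfl (by omega) (by omega)
        (by omega) (by omega) (by omega) (by omega)
      have e3 := ver (2 * (i : ℤ) + 4) (3 - 2 * ((i : ℤ) % 2)) _ _ rfl rfl (by omega) (by omega)
        (by omega) (by omega) (by omega) (by omega)
      rw [e0, e1, e2, e3]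
      rcases Int.emod_two_eq_zero_or_one (i : ℤ) with hi | hi <;> rw [hi] <;> norm_num
      · linear_combination zmod_two_add_self (P (2 * i + 2) 4) +
          zmod_two_add_self (P (2 * i + 4) 4)
      · linear_combination zmod_two_add_self (P (2 * i + 2) 0) +
          zmod_two_add_self (P (2 * i + 4) 0)
    have hfirst := hor 1 2 0 2 (by norm_num) (by norm_num) (by norm_num) (by norm_num)
      (by norm_num) (by omega) (by norm_num) (by norm_num)
    have hlast := hor (2 * n + 3) 2 (2 * n + 2) (2 * n + 4) (by ring) (by ring) (by omega)
      (by norm_num) (by omega) (by omega) (by norm_num) (by norm_num)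
    have hne := ne_of_mem_internal (b := 2) hRo (by push_cast; omega) hk hu
    have hP0 : P 0 2 = 0 := if_neg hne.1
    have hP1 : P (2 * n + 4) 2 = 0 := if_neg (by
      have := hne.2
      push_cast at this
      rwa [mul_add, show (2 : ℤ) * 2 = 4 by norm_num] at this)
    refine (sum_tubeOpp h (fun e => incidence (n + 2) R ((tubePoint n e).1, (tubePoint n e).2, k) u)
      f13).trans ?_
    have l0 : (tubePoint n (.inl 0)) = (1, 2) := by simp [tubePoint]
    have l1 : (tubePoint n (.inl 1)) = (2 * (n : ℤ) + 3, 2) := by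
      simp [tubePoint, add_assoc]
    have l2 : ∀ i : Fin n, tubePoint n (.inr (i, 0)) = (2 * (i : ℤ) + 3, 2) := fun i => rfl
    simp only [l0, l1, l2, f0, hfirst, hlast]
    rw [sum_telescope fun i => P (2 * (i : ℤ) + 2) 2, hP0, hP1, Nat.cast_zero, mul_zero, zero_add,
      zero_add (2 : ℤ)]
    linear_combination zmod_two_add_self (P 2 2) + zmod_two_add_self (P (2 * n + 2) 2)
  -- Blocks lie at `u₁ ≥ 2`, so the recovery set is met only by the left end edge.
  · have hn1 : ∀ i : Fin n, ∀ j,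
        ((tubePoint n (.inr (i, j))).1, (tubePoint n (.inr (i, j))).2, k) ∉
          recoveryX (n + 2) R := fun i j => by
      refine notMem_recoveryX ?_
      fin_cases j <;> simp [tubePoint] <;> omega
    refine (sum_tubeOpp h (fun e =>
      if ((tubePoint n e).1, (tubePoint n e).2, k) ∈ recoveryX (n + 2) R then 1 else 0)
      fun i => ?_).trans ?_
    · simp only [hn1, if_false, add_zero]
    · rw [if_pos (mem_recoveryX (hA _ k hk h1 h2) ⟨1, rfl⟩ hk (by simp [tubePoint])),
        if_neg (notMem_recoveryX _)]
      · simp only [hn1, if_false, Finset.sum_const_zero, add_zero]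
      · simp [tubePoint]
        omega

/-! ### From code bounds to the thresholds. -/

/-- Sites of type `(o, e, ·)` are qubits in planes of either parity, and each plane has `d ^ 2` of
them. -/
theorem sq_le_card_sheet {d R k : ℕ} (hk₀ : 1 ≤ k) (hk₁ : k ≤ R) :
    d ^ 2 ≤ (sheet d R k).card := by
  have h : ((Finset.range d ×ˢ Finset.range d).image fun a : ℕ × ℕ =>
      (((2 * a.1 + 1 : ℤ), (2 * a.2 : ℤ), (k : ℤ)) : Site)) ⊆ sheet d R k := by
    intro s hs
    obtain ⟨⟨i, j⟩, hij, rfl⟩ := Finset.mem_image.1 hs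
    simp only [Finset.mem_product, Finset.mem_range] at hij
    simp only [sheet, qubits, Finset.mem_filter, Finset.mem_product, Finset.mem_Icc, Int.odd_iff,
      Int.even_iff, and_true]
    omega
  refine le_trans (le_of_eq ?_) (Finset.card_le_card h)
  rw [Finset.card_image_of_injective, Finset.card_product, Finset.card_range, pow_two]
  rintro ⟨i, j⟩ ⟨i', j'⟩ h
  simp only [Prod.mk.injEq] at h ⊢
  omega

theorem div_three_le_half_sub_one {R : ℕ} (hR : 3 ≤ R) (hRo : Odd R) :
    (R : ℝ) / 3 ≤ ((R - 1) / 2 : ℕ) := by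
  obtain ⟨m, rfl⟩ := hRo
  rw [show (2 * m + 1 - 1) / 2 = m by omega]
  have : (1 : ℝ) ≤ m := by exact_mod_cast (by omega : 1 ≤ m)
  push_cast
  linarith

theorem exists_forall_bellProb_le {p : ℝ} (hp₀ : 0 < p) (hp : p ≤ 1 / 4) :
    ∃ d₀ : ℕ, ∀ d R : ℕ, d₀ ≤ d → 2 ≤ d → Even d → 3 ≤ R → Odd R →
      (1 / (2 * √p)) ^ d ≤ (R : ℝ) →
        ∀ gX gZ : Finset Site → ZMod 2, bellProb d R p gX gZ 0 0 ≤ 3 / 4 := by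
  rcases le_or_gt (1 / 8) (p * (1 - p)) with h | h
  · refine ⟨0, fun d R _ hd _ hR _ _ gX gZ => ?_⟩
    have := bellProb_le_of_endBits (d := d) (by omega) hR hp₀.le (by linarith) gX gZ
    linarith
  · have hs : 0 < 2 * √p := by positivity
    set r := blockRate p / (2 * √p) with hr
    have hr1 : 1 < r := (one_lt_div hs).2 (two_mul_sqrt_lt_blockRate hp₀ hp h)
    have hr0 : 0 < r := by linarith
    have hlim := (tendsto_pow_const_div_const_pow_of_one_lt 2 hr1).eventually_lt_const
      (by positivity : 0 < p / (6 * r))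
    obtain ⟨m, hm⟩ := Filter.eventually_atTop.1 hlim
    -- The offset gives `n = d - 2 ≥ m + 2`, which covers both `n + 1 ≥ m` and `n ≥ 2`, as required
    -- for the tube to fit.
    refine ⟨m + 4, fun d R hd _ hde hR hRo hRd gX gZ => ?_⟩
    obtain ⟨n, rfl⟩ : ∃ n, d = n + 2 := ⟨d - 2, by omega⟩
    have hn : Even n := by
      rw [Nat.even_add] at hde
      exact hde.2 even_two
    refine bellProb_le_of_tubes (by omega) hn hR hRo (N := (R - 1) / 2) (by omega) hp₀
      (by linarith) gX gZ ?_
    have h1 := hm (n + 1) (by omega)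
    rw [div_lt_div_iff₀ (by positivity) (by positivity), pow_succ r n] at h1
    push_cast at h1
    have h2 : 6 * ((n : ℝ) + 1) ^ 2 ≤ p * r ^ n := by
      have : (6 * ((n : ℝ) + 1) ^ 2) * r ≤ (p * r ^ n) * r := by linarith
      exact le_of_mul_le_mul_right this hr0
    have h3 := (div_le_div_of_nonneg_right hRd (by norm_num : (0 : ℝ) ≤ 3)).trans
      (div_three_le_half_sub_one hR hRo)
    -- This is where the `6` comes from: the `3` of `N ≥ R / 3`, and `2 p ^ 2 / (4 p)` from the end
    -- edges, since `d` exceeds the number of blocks by two.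
    have h4 : 2 * p ^ 2 * blockRate p ^ n / ((n : ℝ) + 1) ^ 2 * ((1 / (2 * √p)) ^ (n + 2) / 3) =
        p * r ^ n / (6 * ((n : ℝ) + 1) ^ 2) := by
      have hb : blockRate p = r * (2 * √p) := by rw [hr]; field_simp
      have hsq : (2 * √p) ^ 2 = 4 * p := by
        rw [mul_pow, Real.sq_sqrt hp₀.le]; norm_num
      rw [hb, one_div, inv_pow, mul_pow, pow_add, hsq]
      field_simp
      norm_num
    have h0 : 0 ≤ 2 * p ^ 2 * blockRate p ^ n / ((n : ℝ) + 1) ^ 2 := by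
      have : 0 ≤ blockRate p := by unfold blockRate; positivity
      positivity
    calc (1 : ℝ) ≤ p * r ^ n / (6 * ((n : ℝ) + 1) ^ 2) := (one_le_div (by positivity)).2 h2
      _ = _ := h4.symm
      _ ≤ _ := mul_le_mul_of_nonneg_left h3 h0
      _ = _ := mul_comm _ _

/-- A cruder threshold, from straight lines, but valid for every `d ≥ 2` of either parity; this is
what the bound on the number of qubits needs. The `3` in the base absorbs `N ≥ R / 3`. -/
theorem bellProb_le_of_pow_le {p : ℝ} (hp₀ : 0 < p) (hp : p ≤ 1 / 4) {d R : ℕ} (hd : 2 ≤ d)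
    (hR : 3 ≤ R) (hRo : Odd R) (h : (3 / (2 * p)) ^ d ≤ (R : ℝ)) (gX gZ : Finset Site → ZMod 2) :
    bellProb d R p gX gZ 0 0 ≤ 3 / 4 := by
  have h1 := bellProb_le_of_lines hd hR hRo (N := (R - 1) / 2) (by omega) hp₀ (by linarith) gX gZ
  have h2 : (2 * p) ^ d ≤ 1 := pow_le_one₀ (by positivity) (by linarith)
  have h3 := div_three_le_half_sub_one hR hRo
  have h4 : 3 / (2 * p) ^ d ≤ (R : ℝ) := by
    refine le_trans ?_ h
    rw [div_pow]
    gcongr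
    exact le_self_pow₀ (by norm_num) (by omega)
  have h5 : 1 ≤ (((R - 1) / 2 : ℕ) : ℝ) * (2 * p) ^ d := by
    have hpos : 0 < (2 * p) ^ d := by positivity
    rw [div_le_iff₀ hpos] at h4
    nlinarith [mul_le_mul_of_nonneg_right h3 hpos.le]
  linarith [one_sub_pow_le_half h2 h5]

/-- Success above `3 / 4` forces `R < (3 / (2 p)) ^ d`, so `d` is at least a constant times `log R`,
while a plane has at least `d ^ 2` qubits. -/
theorem exists_forall_log_sq_le {p : ℝ} (hp₀ : 0 < p) (hp : p ≤ 1 / 4) :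
    ∃ c : ℝ, 0 < c ∧ ∀ d R : ℕ, 2 ≤ d → 3 ≤ R → Odd R → ∀ gX gZ : Finset Site → ZMod 2,
      3 / 4 < bellProb d R p gX gZ 0 0 → ∀ k : ℕ, 1 ≤ k → k ≤ R →
        c * Real.log R ^ 2 ≤ ((sheet d R k).card : ℝ) := by
  have hK : 1 < 3 / (2 * p) := by rw [one_lt_div (by positivity)]; linarith
  have hL : 0 < Real.log (3 / (2 * p)) := Real.log_pos hK
  refine ⟨1 / Real.log (3 / (2 * p)) ^ 2, by positivity, ?_⟩
  intro d R hd hR hRo gX gZ hν k hk₀ hk₁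
  have h1 : (R : ℝ) < (3 / (2 * p)) ^ d := by
    by_contra! h
    exact absurd (bellProb_le_of_pow_le hp₀ hp hd hR hRo h gX gZ) (not_le.2 hν)
  have hR0 : (1 : ℝ) ≤ R := by exact_mod_cast (by omega : 1 ≤ R)
  have h2 : Real.log R ≤ d * Real.log (3 / (2 * p)) := by
    rw [← Real.log_pow]
    exact Real.log_le_log (by linarith) h1.le
  have h3 : Real.log R ^ 2 ≤ d ^ 2 * Real.log (3 / (2 * p)) ^ 2 := by
    rw [← mul_pow]
    exact pow_le_pow_left₀ (Real.log_nonneg hR0) h2 2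
  have h4 : ((d ^ 2 : ℕ) : ℝ) ≤ (sheet d R k).card := by exact_mod_cast sq_le_card_sheet hk₀ hk₁
  refine le_trans ?_ h4
  rw [one_div, ← div_eq_inv_mul, div_le_iff₀ (by positivity)]
  exact_mod_cast h3

end ClusterProtocol

end

theorem mainTheorem4 (p : ℝ) (hp₀ : 0 < p) (hp : p ≤ 1 / 4) :
    (∃ d₀ : ℕ, ∀ d R : ℕ, d₀ ≤ d → 2 ≤ d → Even d → 3 ≤ R → Odd R →
      (1 / (2 * √p)) ^ d ≤ (R : ℝ) →
      (∀ M M' : Finset ClusterProtocol.Site → Finset (Sym2 ClusterProtocol.Site),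
        (ClusterProtocol.decGraph d R).IsMinMatch M →
        (ClusterProtocol.dualDecGraph d R).IsMinMatch M' →
        ClusterProtocol.bellProb d R p (ClusterProtocol.estimateX d R M)
          (ClusterProtocol.estimateZ d R M') 0 0 ≤ 3 / 4) ∧
      (∀ gX gZ : Finset ClusterProtocol.Site → ZMod 2,
        ClusterProtocol.bellProb d R p gX gZ 0 0 ≤ 3 / 4)) ∧
    (∃ c : ℝ, 0 < c ∧ ∀ d R : ℕ, 2 ≤ d → 3 ≤ R → Odd R →
      ∀ gX gZ : Finset ClusterProtocol.Site → ZMod 2,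
        3 / 4 < ClusterProtocol.bellProb d R p gX gZ 0 0 →
        ∀ k : ℕ, 1 ≤ k → k ≤ R →
          c * Real.log R ^ 2 ≤ ((ClusterProtocol.sheet d R k).card : ℝ)) := by
  refine ⟨?_, ClusterProtocol.exists_forall_log_sq_le hp₀ hp⟩
  obtain ⟨d₀, h⟩ := ClusterProtocol.exists_forall_bellProb_le hp₀ hp
  refine ⟨d₀, fun d R h1 h2 h3 h4 h5 h6 => ⟨fun M M' _ _ => ?_, fun gX gZ => ?_⟩⟩
  · exact h d R h1 h2 h3 h4 h5 h6 _ _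
  · exact h d R h1 h2 h3 h4 h5 h6 gX gZ
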